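/- Let $d\ge 2$, $1\le D\le d$, $N\ge 1$, $\beta,\gamma>0$ and $S_N^d=[-N,N]^d\cap\mathbb Z^d$. Let $\Delta$ be the discrete Neumann Laplacian on $S_N^d$, $(\Delta f)(\mathbf x)=\sum_{\mathbf y\sim\mathbf x}(f(\mathbf y)-f(\mathbf x))$, the sum running over the nearest neighbours $\mathbf y\in S_N^d$ of $\mathbf x$, and let $(\varphi_{\mathbf k})$ be an orthonormal basis of real functions on $S_N^d$ with $-\Delta\varphi_{\mathbf k}=\lambda_{\mathbf k}\varphi_{\mathbf k}$, where $\mathbf k=\mathbf 0$ is the index of the constant eigenfunction, $\lambda_{\mathbf 0}=0$. Under the probability measure $P_N$ let $X^{(i)}_{\mathbf k}$ ($\mathbf k\ne\mathbf 0$, $1\le i\le D$) be independent with $X_{\mathbf k}^{(i)}\sim N(0,(2\beta\lambda_{\mathbf k})^{-1})$, and let $\mathbf u=(u^{(1)},\dots,u^{(D)})$ with $u^{(i)}=\sum_{\mathbf k\neq\mathbf 0}X^{(i)}_{\mathbf k}\varphi_{\mathbf k}$ be the $\mathbb R^D$-valued discrete Gaussian free field (DGFF). Let $\ell_N(\mathbf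 z)=\#\{\mathbf x\in S_N^d:\ |u^{(i)}(\mathbf x)-z_i|\le \tfrac12 \text{ for all } i\}$ be its local time at $\mathbf z\in\mathbb R^D$, and let $Q_N$ be the law of the weakly self-avoiding DGFF, $$Q_N(A)=\frac{E^{P_N}\big[\mathbf 1_A\,e^{-\gamma\int_{\mathbb R^D}\ell_N(\mathbf y)^2d\mathbf y}\big]}{E^{P_N}\big[e^{-\gamma\int_{\mathbb R^D}\ell_N(\mathbf y)^2d\mathbf y}\big]}.$$ Let $R_N=\max_{\mathbf w,\mathbf z\in S_N^d}\|\mathbf u(\mathbf z)-\mathbf u(\mathbf w)\|$ be the effective radius ($\|\cdot\|$ is the Euclidean norm). (i) For $d=2$, $D=1$ there are constants $\varepsilon_0,K_0>0$ such that for all $\beta,\gamma>0$ $$\lim_{N\to\infty}Q_N\Big[\varepsilon_0\frac{\gamma}{\beta+\gamma}N^{4/3}(\log N)^{-2/3}\le R_N\le K_0\Big(\frac{\beta+\gamma}{\beta}\Big)^{1/2}N^{4/3}(\log N)^{4/3}\Big]=1.$$ (ii) For all $d\ge 3$ and $1\le D\le d$ there are constants $\varepsilon_0,K_0>0$, depending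 only on $d$ and $D$, such that for all $\beta,\gamma>0$ $$\lim_{N\to\infty}Q_N\Big[\varepsilon_0\Big(\frac{\gamma}{\beta+\gamma}\Big)^{1/D}N^{\frac1D\left(d-\frac{2(d-D)}{D+2}\right)}\le R_N\le K_0\Big(\frac{\beta+\gamma}{\beta}\Big)^{1/2}N^{\frac d2+\frac{d-D}{D+2}}\Big]=1.$$ -/

import Mathlib

open Filter Topology MeasureTheory ProbabilityTheory

noncomputable section

namespace ElasticManifold

/-- The parameter set `S_N^d = [-N, N]^d ∩ ℤ^d`. -/
abbrev Site (d N : ℕ) : Type := Fin d → ↥(Finset.Icc (-(N : ℤ)) (N : ℤ))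

/-- The nearest neighbour graph on `S_N^d`: two sites are adjacent if and only if their `ℓ¹`
distance is one. -/
def boxGraph (d N : ℕ) : SimpleGraph (Site d N) where
  Adj x y := ∑ i, |(x i : ℤ) - (y i : ℤ)| = 1
  symm := ⟨fun x y h => by simpa only [abs_sub_comm] using h⟩
  loopless := ⟨fun x h => by simp at h⟩

instance (d N : ℕ) : DecidableRel (boxGraph d N).Adj := fun x y =>
  inferInstanceAs (Decidable (∑ i, |(x i : ℤ) - (y i : ℤ)| = 1))

/-- The matrix of `-Δ`, where `Δ` is the discrete Laplacian on `S_N^d` with Neumann (free)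
boundary conditions, `(Δ f) x = ∑_{y ∼ x} (f y - f x)`, the sum running over the nearest
neighbours `y` of `x` inside `S_N^d`. -/
def negLaplacian (d N : ℕ) : Matrix (Site d N) (Site d N) ℝ := (boxGraph d N).lapMatrix ℝ

theorem negLaplacian_mulVec_apply (d N : ℕ) (f : Site d N → ℝ) (x : Site d N) :
    (negLaplacian d N).mulVec f x = -∑ y ∈ (boxGraph d N).neighborFinset x, (f y - f x) := by
  rw [negLaplacian, SimpleGraph.lapMatrix_mulVec_apply, Finset.sum_sub_distrib, Finset.sum_const,
    SimpleGraph.card_neighborFinset_eq_degree, nsmul_eq_mul]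
  ring

theorem negLaplacian_isHermitian (d N : ℕ) : (negLaplacian d N).IsHermitian :=
  SimpleGraph.isHermitian_lapMatrix ℝ (boxGraph d N)

/-- The eigenvalues `lam k`, `k ∈ S_N^d`, of `-Δ`, counted with multiplicity. -/
def lam (d N : ℕ) (k : Site d N) : ℝ := (negLaplacian_isHermitian d N).eigenvalues k

/-- An orthonormal basis of eigenfunctions of `-Δ`; `eigenfun d N k` has eigenvalue `lam d N k`. -/
def eigenfun (d N : ℕ) (k : Site d N) (x : Site d N) : ℝ :=
  (negLaplacian_isHermitian d N).eigenvectorBasis k x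

/-- The indices other than the distinguished index of the constant eigenfunction. The graph is
connected, so that the eigenvalue zero is simple and belongs to that index alone. -/
abbrev Mode (d N : ℕ) : Type := {k : Site d N // lam d N k ≠ 0}

/-- The joint law `P` of the independent centred Gaussian variables `X_k^{(i)}` with variances
`(2 β lam_k)⁻¹`, realised as coordinates on the product space. -/
def gaussianLaw (d D N : ℕ) (β : ℝ) : Measure (Fin D × Mode d N → ℝ) :=
  Measure.pi fun p => gaussianReal 0 (Real.toNNReal ((2 * β * lam d N p.2)⁻¹))

/-- The discrete Gaussian free field `u = (u^{(1)}, …, u^{(D)})`, where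
`u^{(i)}(x) = ∑_k X_k^{(i)} φ_k(x)`. -/
def field (d D N : ℕ) (X : Fin D × Mode d N → ℝ) (x : Site d N) : EuclideanSpace ℝ (Fin D) :=
  WithLp.toLp 2 fun i => ∑ k : Mode d N, X (i, k) * eigenfun d N k x

/-- The cube `[z - 1/2, z + 1/2]` in `ℝ^D`. -/
def unitCube {D : ℕ} (z : EuclideanSpace ℝ (Fin D)) : Set (EuclideanSpace ℝ (Fin D)) :=
  {y | ∀ i, y i ∈ Set.Icc (z i - 1 / 2) (z i + 1 / 2)}

/-- The local time of a configuration `v` at level `z`: the number of sites `x` such that `v x`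
lies in `[z - 1/2, z + 1/2]`. -/
def localTime {d D N : ℕ} (v : Site d N → EuclideanSpace ℝ (Fin D))
    (z : EuclideanSpace ℝ (Fin D)) : ℝ :=
  ∑ x, (unitCube z).indicator (fun _ => (1 : ℝ)) (v x)

/-- The weight `exp (-γ ∫ ℓ(y)² dy)`. -/
def weight {d D N : ℕ} (γ : ℝ) (v : Site d N → EuclideanSpace ℝ (Fin D)) : ℝ :=
  Real.exp (-γ * ∫ y, localTime v y ^ 2)

/-- The partition function `Z = E[exp (-γ ∫ ℓ(y)² dy)]`. -/
def partitionFunction (d D N : ℕ) (β γ : ℝ) : ℝ :=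
  ∫ X, weight γ (field d D N X) ∂(gaussianLaw d D N β)

/-- The weakly self-avoiding measure `Q`, `Q(A) = Z⁻¹ E[exp (-γ ∫ ℓ(y)² dy) 1_A]`. -/
def selfAvoidingLaw (d D N : ℕ) (β γ : ℝ) : Measure (Fin D × Mode d N → ℝ) :=
  (gaussianLaw d D N β).withDensity fun X =>
    ENNReal.ofReal (weight γ (field d D N X) / partitionFunction d D N β γ)

/-- The effective radius `max_{w, z} ‖v z - v w‖` (Euclidean norm) of a configuration; the supremum
is over a finite non-empty set. -/
def effectiveRadius {d D N : ℕ} (v : Site d N → EuclideanSpace ℝ (Fin D)) : ℝ :=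
  ⨆ p : Site d N × Site d N, ‖v p.1 - v p.2‖

end ElasticManifold

end

/-!
The measure `Q` favours configurations that balance the Gaussian energy against the self-intersection
energy `γ ∫ ℓ²`, and both are of order `(β + γ) N ^ E` with `E = d + 2 (d - D) / (D + 2)` for a
configuration of the right size. The theorem follows from three facts.

* *The partition function is at least `exp (-C (β + γ) N ^ E)`*
  (`exp_rpow_le_partitionFunction`). The free field is compared with a Gaussian field
  (`stretchedLaw`) with the same modes, whose mean is the linear map `x ↦ a (x₁, …, x_D)` and whose
  modes all have the additional variance `a²`; the latter amounts to independent noise of size `a`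
  at the different sites. By Jensen's inequality (`ofReal_exp_le_lintegral_pi_gaussianReal`) the
  price is a relative entropy of order `β a² N ^ d` plus the expected self-intersection energy. For
  two sites `x ≠ y` the increment of a component is Gaussian with mean `a (x_i - y_i)` and a variance
  comparable with a constant `w₀ ≥ a²`, so the number of sites `y` expected to be close to `x` is of
  order `N ^ (d - D) / a ^ D`: the sum over the values of `x_i - y_i` costs only `1 / a`
  (`sum_hitBound_le`). The slope `a = N ^ ((d - D) / (D + 2))` balances both contributions. If `d = D`
  then `a = 1`, and the comparison of the variance with `w₀` uses lower as well as upper bounds of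
  effective resistances; this keeps the constants independent of `β`.
* *A small radius is expensive*: by the Cauchy-Schwarz inequality `∫ ℓ²` is at least the squared
  number of sites over the volume that the field can occupy (`div_le_integral_localTime_sq`).
* *A large radius is unlikely* already under the Gaussian law, by a union bound
  (`gaussianLaw_lt_effectiveRadius_le`).

The increments of the free field have variance `resistance x y / (2 β)`, and the estimate of the
effective resistance does not need the eigenfunctions. By Thomson's principle (`resistance_le`) it
suffices to bound `(f x - f y) ^ 2` by the Dirichlet energy of `f`. For this, `f x` is compared with
the averages of `f` over dyadic cubes near `x`; moving a cube of side `m` by `m` steps changes the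
average by at most `m ^ (1 - d / 2)` times the root of the energy (`abs_cubeAvg_sub_le`). The sum over
scales is bounded for `d ≥ 3` and logarithmic for `d = 2`.
-/

noncomputable section

namespace ElasticManifold

open scoped ENNReal NNReal

/-! ### Oscillation of a function on the box in terms of its Dirichlet energy -/

/-- Twice the Dirichlet energy of `f`: the sum of the squared increments over oriented edges. -/
def edgeEnergy (d N : ℕ) (f : Site d N → ℝ) : ℝ :=
  ∑ x, ∑ y, if (boxGraph d N).Adj x y then (f x - f y) ^ 2 else 0

lemma edgeEnergy_nonneg {d N : ℕ} (f : Site d N → ℝ) : 0 ≤ edgeEnergy d N f :=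
  Finset.sum_nonneg fun x _ => Finset.sum_nonneg fun y _ => by split_ifs <;> positivity

/-- The nearest point projection of `ℤ^d` onto the box; only its values on the box matter, it
serves to evaluate functions on the box at points of `ℤ^d`. -/
def clamp {d N : ℕ} (y : Fin d → ℤ) : Site d N := fun i =>
  ⟨max (-(N : ℤ)) (min N (y i)), by simp⟩

lemma clamp_apply {d N : ℕ} {y : Fin d → ℤ} {i : Fin d} (h₁ : -(N : ℤ) ≤ y i) (h₂ : y i ≤ N) :
    ((clamp y : Site d N) i : ℤ) = y i := by
  simp [clamp, h₁, h₂]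

lemma clamp_coe {d N : ℕ} (x : Site d N) : clamp (fun i => (x i : ℤ)) = x := by
  funext i
  have := Finset.mem_Icc.1 (x i).2
  exact Subtype.ext (clamp_apply this.1 this.2)

/-- The average of `f` over the cube with lower corner `l` and side `m`. -/
def cubeAvg {d N : ℕ} (f : Site d N → ℝ) (l : Fin d → ℤ) (m : ℕ) : ℝ :=
  (∑ b : Fin d → Fin m, f (clamp fun i => l i + (b i : ℕ))) / (m : ℝ) ^ d

/-- The cube with lower corner `l` and side `m` lies in the box. -/
def CubeIn (d N : ℕ) (l : Fin d → ℤ) (m : ℕ) : Prop :=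
  ∀ i, -(N : ℤ) ≤ l i ∧ l i + m ≤ N + 1

lemma abs_cubeAvg_sub_le_of_unit {d N : ℕ} (f : Site d N → ℝ) {m : ℕ} (hm : 0 < m)
    {l l' : Fin d → ℤ} (hl : CubeIn d N l m) (hl' : CubeIn d N l' m)
    (h : ∑ i, |l i - l' i| = 1) :
    |cubeAvg f l' m - cubeAvg f l m| ≤ √(edgeEnergy d N f / (m : ℝ) ^ d) := by
  have hm' : (0 : ℝ) < (m : ℝ) ^ d := by positivity
  have hb : ∀ (b : Fin d → Fin m) {k : Fin d → ℤ}, CubeIn d N k m → ∀ i,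
      ((clamp (fun i => k i + (b i : ℕ)) : Site d N) i : ℤ) = k i + (b i : ℕ) := by
    intro b k hk i
    have := hk i
    have := (b i).2
    exact clamp_apply (by omega) (by omega)
  set p : (Fin d → Fin m) → Site d N := fun b => clamp fun i => l i + (b i : ℕ)
  set q : (Fin d → Fin m) → Site d N := fun b => clamp fun i => l' i + (b i : ℕ)
  have hinj : Function.Injective p := by
    intro b b' hbb
    funext i
    have h1 := hb b hl i
    have h2 := hb b' hl i
    have h3 : ((p b) i : ℤ) = (p b') i := by rw [hbb]
    have : l i + (b i : ℕ) = l i + (b' i : ℕ) := by rw [← h1, ← h2]; exact h3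
    exact Fin.ext (by omega)
  have hadj : ∀ b, (boxGraph d N).Adj (p b) (q b) := by
    intro b
    change ∑ i, |((p b) i : ℤ) - (q b) i| = 1
    rw [← h]
    refine Finset.sum_congr rfl fun i _ => ?_
    rw [hb b hl i, hb b hl' i]
    congr 1
    ring
  have hE : ∑ b, (f (q b) - f (p b)) ^ 2 ≤ edgeEnergy d N f := by
    calc ∑ b, (f (q b) - f (p b)) ^ 2
        ≤ ∑ b, ∑ y, (if (boxGraph d N).Adj (p b) y then (f (p b) - f y) ^ 2 else 0) := by
          refine Finset.sum_le_sum fun b _ => ?_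
          have := Finset.single_le_sum (s := Finset.univ)
            (f := fun y => if (boxGraph d N).Adj (p b) y then (f (p b) - f y) ^ 2 else 0)
            (fun y _ => by split_ifs <;> positivity) (Finset.mem_univ (q b))
          simp only [hadj b, if_true] at this
          rw [sub_sq_comm] at this
          exact this
      _ = ∑ x ∈ Finset.univ.image p,
            ∑ y, (if (boxGraph d N).Adj x y then (f x - f y) ^ 2 else 0) := by
          rw [Finset.sum_image fun a _ b _ hab => hinj hab]
      _ ≤ edgeEnergy d N f :=
          Finset.sum_le_sum_of_subset_of_nonneg (Finset.subset_univ _) fun x _ _ =>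
            Finset.sum_nonneg fun y _ => by split_ifs <;> positivity
  have hdiff : cubeAvg f l' m - cubeAvg f l m = (∑ b, (f (q b) - f (p b))) / (m : ℝ) ^ d := by
    rw [cubeAvg, cubeAvg, ← sub_div, ← Finset.sum_sub_distrib]
  rw [hdiff]
  refine Real.abs_le_sqrt ?_
  have hcs : (∑ b, (f (q b) - f (p b))) ^ 2 ≤ (m : ℝ) ^ d * ∑ b, (f (q b) - f (p b)) ^ 2 := by
    have := sq_sum_le_card_mul_sum_sq (s := Finset.univ) (f := fun b => f (q b) - f (p b))
    simpa using this
  rw [div_pow, div_le_div_iff₀ (by positivity) hm', sq ((m : ℝ) ^ d), ← mul_assoc]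
  refine mul_le_mul_of_nonneg_right ?_ hm'.le
  calc _ ≤ _ := hcs
    _ ≤ _ := by rw [mul_comm]; exact mul_le_mul_of_nonneg_right hE hm'.le

/-- Moving a cube inside the box, one unit step after the other. -/
lemma abs_cubeAvg_sub_le {d N : ℕ} (f : Site d N → ℝ) {m : ℕ} (hm : 0 < m)
    (n : ℕ) (l l' : Fin d → ℤ) (hl : CubeIn d N l m) (hl' : CubeIn d N l' m)
    (h : ∑ i, |l i - l' i| ≤ n) :
    |cubeAvg f l' m - cubeAvg f l m| ≤ n * √(edgeEnergy d N f / (m : ℝ) ^ d) := by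
  induction n generalizing l with
  | zero =>
    have h0 : ∑ i, |l i - l' i| = 0 :=
      le_antisymm (by simpa using h) (Finset.sum_nonneg fun _ _ => abs_nonneg _)
    have : l = l' := by
      funext i
      have := (Finset.sum_eq_zero_iff_of_nonneg fun _ _ => abs_nonneg _).1 h0 i (Finset.mem_univ i)
      have := abs_eq_zero.1 this
      omega
    simp [this]
  | succ n ih =>
    by_cases hll : l = l'
    · subst hll
      simp only [sub_self, abs_zero]
      positivity
    obtain ⟨i, hi⟩ := Function.ne_iff.1 hll
    set k : Fin d → ℤ := Function.update l i (if l i < l' i then l i + 1 else l i - 1) with hk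
    have hkj : ∀ j, j ≠ i → k j = l j := fun j hj => by simp [hk, hj]
    have hki : k i = if l i < l' i then l i + 1 else l i - 1 := by simp [hk]
    have hkin : CubeIn d N k m := by
      intro j
      by_cases hj : j = i
      · subst hj
        have := hl j
        have := hl' j
        rw [hki]
        split_ifs <;> omega
      · rw [hkj j hj]; exact hl j
    have hlk : ∑ j, |l j - k j| = 1 := by
      rw [Finset.sum_eq_single i (fun j _ hj => by simp [hkj j hj]) (by simp), hki]
      split_ifs <;> simp
    have hkl : ∑ j, |k j - l' j| ≤ n := by
      have : ∑ j, |k j - l' j| + 1 = ∑ j, |l j - l' j| := by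
        rw [← Finset.add_sum_erase _ _ (Finset.mem_univ i),
          ← Finset.add_sum_erase _ (fun j => |l j - l' j|) (Finset.mem_univ i),
          Finset.sum_congr rfl fun j hj => by rw [hkj j (Finset.ne_of_mem_erase hj)], hki]
        have : |(if l i < l' i then l i + 1 else l i - 1) - l' i| + 1 = |l i - l' i| := by
          split_ifs
          · rw [abs_of_nonpos (by omega), abs_of_neg (by omega)]; ring
          · rw [abs_of_nonneg (by omega), abs_of_pos (by omega)]; ring
        rw [← this]
        ring
      push_cast at h
      omega
    have h1 := ih k hkin hkl
    have h2 := abs_cubeAvg_sub_le_of_unit f hm hl hkin hlk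
    calc |cubeAvg f l' m - cubeAvg f l m|
        ≤ |cubeAvg f l' m - cubeAvg f k m| + |cubeAvg f k m - cubeAvg f l m| :=
          abs_sub_le _ _ _
      _ ≤ _ := by push_cast; linarith

/-- A cube of side `2 m` is the union of `2 ^ d` cubes of side `m`. -/
lemma cubeAvg_two_mul {d N : ℕ} (f : Site d N → ℝ) (l : Fin d → ℤ) (m : ℕ) :
    cubeAvg f l (2 * m) =
      (∑ e : Fin d → Fin 2, cubeAvg f (fun i => l i + m * (e i : ℕ)) m) / 2 ^ d := by
  simp only [cubeAvg]
  rw [← Finset.sum_div, div_div, ← mul_pow, mul_comm (m : ℝ) 2]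
  push_cast
  congr 1
  rw [← Fintype.sum_prod_type']
  let φ : (Fin d → Fin 2) × (Fin d → Fin m) ≃ (Fin d → Fin (2 * m)) :=
    (Equiv.arrowProdEquivProdArrow (Fin d) (fun _ => Fin 2) (fun _ => Fin m)).symm.trans
      (Equiv.arrowCongr (Equiv.refl _) finProdFinEquiv)
  refine (Fintype.sum_equiv φ _ _ fun p => ?_).symm
  congr 2
  funext i
  have : ((φ p i : Fin (2 * m)) : ℕ) = (p.2 i : ℕ) + m * (p.1 i : ℕ) := by
    simp [φ, Equiv.arrowProdEquivProdArrow]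
  rw [this]
  push_cast
  ring

/-- The lower corner of the cube of side `m` at `x`, pushed into the box where necessary. -/
def corner {d N : ℕ} (x : Site d N) (m : ℕ) : Fin d → ℤ := fun i => min (x i : ℤ) (N + 1 - m)

lemma cubeIn_corner {d N : ℕ} (x : Site d N) {m : ℕ} (hm : m ≤ 2 * N + 1) :
    CubeIn d N (corner x m) m := by
  intro i
  have := Finset.mem_Icc.1 (x i).2
  simp only [corner]
  omega

lemma cubeAvg_corner_one {d N : ℕ} (f : Site d N → ℝ) (x : Site d N) :
    cubeAvg f (corner x 1) 1 = f x := by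
  have : ∀ b : Fin d → Fin 1, (clamp fun i => corner x 1 i + (b i : ℕ) : Site d N) = x := by
    intro b
    conv_rhs => rw [← clamp_coe x]
    congr 1
    funext i
    have := Finset.mem_Icc.1 (x i).2
    have h0 : ((b i : Fin 1) : ℕ) = 0 := by omega
    simp only [corner, h0]
    push_cast
    omega
  rw [cubeAvg, Finset.sum_congr rfl fun b _ => by rw [this b]]
  simp

lemma sum_abs_sub_le {d : ℕ} {l l' : Fin d → ℤ} {m : ℕ} (h : ∀ i, |l i - l' i| ≤ m) :
    ∑ i, |l i - l' i| ≤ ((d * m : ℕ) : ℤ) := by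
  calc ∑ i, |l i - l' i| ≤ ∑ _i : Fin d, (m : ℤ) := Finset.sum_le_sum fun i _ => h i
    _ = _ := by simp

/-- Comparison of the averages at two consecutive dyadic scales. -/
lemma abs_cubeAvg_corner_two_mul_sub_le {d N : ℕ} (f : Site d N → ℝ) (x : Site d N) {m : ℕ}
    (hm : 0 < m) (hmN : 2 * m ≤ 2 * N + 1) :
    |cubeAvg f (corner x (2 * m)) (2 * m) - cubeAvg f (corner x m) m| ≤
      (d * m : ℕ) * √(edgeEnergy d N f / (m : ℝ) ^ d) := by
  have hbig := cubeIn_corner x hmN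
  have key : ∀ e : Fin d → Fin 2,
      |cubeAvg f (fun i => corner x (2 * m) i + m * (e i : ℕ)) m - cubeAvg f (corner x m) m| ≤
      (d * m : ℕ) * √(edgeEnergy d N f / (m : ℝ) ^ d) := by
    intro e
    have he : ∀ i, (m : ℤ) * (e i : ℕ) = 0 ∨ (m : ℤ) * (e i : ℕ) = m := by
      intro i
      have : ((e i : Fin 2) : ℕ) = 0 ∨ ((e i : Fin 2) : ℕ) = 1 := by omega
      rcases this with h | h <;> simp [h]
    refine abs_cubeAvg_sub_le f hm _ _ _ (cubeIn_corner x (by omega)) (fun i => ?_)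
      (sum_abs_sub_le fun i => ?_)
    · have := hbig i
      push_cast at this
      rcases he i with h | h <;> rw [h] <;> omega
    · simp only [corner]
      push_cast
      rw [abs_le]
      rcases he i with h | h <;> rw [h] <;> omega
  have hpow : (0 : ℝ) < 2 ^ d := by positivity
  rw [cubeAvg_two_mul]
  have : (∑ e : Fin d → Fin 2, cubeAvg f (fun i => corner x (2 * m) i + m * (e i : ℕ)) m) / 2 ^ d
      - cubeAvg f (corner x m) m = (∑ e : Fin d → Fin 2,
        (cubeAvg f (fun i => corner x (2 * m) i + m * (e i : ℕ)) m
          - cubeAvg f (corner x m) m)) / 2 ^ d := by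
    rw [Finset.sum_sub_distrib]
    simp
    field_simp
  rw [this, abs_div, abs_of_pos hpow, div_le_iff₀ hpow]
  calc _ ≤ _ := Finset.abs_sum_le_sum_abs _ _
    _ ≤ ∑ e : Fin d → Fin 2, (d * m : ℕ) * √(edgeEnergy d N f / (m : ℝ) ^ d) :=
        Finset.sum_le_sum fun e _ => key e
    _ = _ := by simp; ring

/-- The oscillation of `f` in terms of its energy, as a sum over the dyadic scales. -/
lemma abs_sub_le_sum_scales {d N : ℕ} (f : Site d N → ℝ) (x y : Site d N) {r : ℝ}
    (hr : ∀ j : ℕ, (2 : ℝ) ^ j * √(edgeEnergy d N f / ((2 : ℝ) ^ j) ^ d) ≤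
      r ^ j * √(edgeEnergy d N f)) :
    |f x - f y| ≤ d * (2 * ∑ j ∈ Finset.range (Nat.log 2 (2 * N + 1)), r ^ j
      + r ^ Nat.log 2 (2 * N + 1)) * √(edgeEnergy d N f) := by
  set J := Nat.log 2 (2 * N + 1)
  have hJ : 2 ^ J ≤ 2 * N + 1 := Nat.pow_log_le_self 2 (by omega)
  have hJ' : 2 * N + 1 < 2 ^ (J + 1) := Nat.lt_pow_succ_log_self (by norm_num) _
  have scale : ∀ (z : Site d N) (j : ℕ), j ≤ J →
      |cubeAvg f (corner z (2 ^ j)) (2 ^ j) - f z| ≤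
        d * (∑ i ∈ Finset.range j, r ^ i) * √(edgeEnergy d N f) := by
    intro z j
    induction j with
    | zero =>
      intro _
      rw [pow_zero, cubeAvg_corner_one]
      simp
    | succ j ih =>
      intro hj
      have h1 := ih (by omega)
      have hle : 2 * 2 ^ j ≤ 2 * N + 1 := by
        rw [← pow_succ']
        exact (Nat.pow_le_pow_right (by norm_num) hj).trans hJ
      have h2 := abs_cubeAvg_corner_two_mul_sub_le f z (m := 2 ^ j) (by positivity) hle
      rw [pow_succ', Finset.sum_range_succ]
      have h3 := hr j
      have h4 : ((d * 2 ^ j : ℕ) : ℝ) * √(edgeEnergy d N f / ((2 ^ j : ℕ) : ℝ) ^ d) ≤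
          d * (r ^ j * √(edgeEnergy d N f)) := by
        push_cast
        rw [mul_assoc]
        exact mul_le_mul_of_nonneg_left h3 (by positivity)
      have h5 := abs_sub_le (cubeAvg f (corner z (2 * 2 ^ j)) (2 * 2 ^ j))
        (cubeAvg f (corner z (2 ^ j)) (2 ^ j)) (f z)
      linarith
  have hx := scale x J le_rfl
  have hy := scale y J le_rfl
  have hxy : |cubeAvg f (corner x (2 ^ J)) (2 ^ J) - cubeAvg f (corner y (2 ^ J)) (2 ^ J)| ≤
      (d * 2 ^ J : ℕ) * √(edgeEnergy d N f / ((2 ^ J : ℕ) : ℝ) ^ d) := by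
    refine abs_cubeAvg_sub_le f (by positivity) _ _ _ (cubeIn_corner y hJ) (cubeIn_corner x hJ)
      (sum_abs_sub_le fun i => ?_)
    have h1 := cubeIn_corner x hJ i
    have h2 := cubeIn_corner y hJ i
    rw [pow_succ] at hJ'
    rw [abs_le]
    zify at *
    omega
  have h3 : ((d * 2 ^ J : ℕ) : ℝ) * √(edgeEnergy d N f / ((2 ^ J : ℕ) : ℝ) ^ d) ≤
      d * (r ^ J * √(edgeEnergy d N f)) := by
    push_cast
    rw [mul_assoc]
    exact mul_le_mul_of_nonneg_left (hr J) (by positivity)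
  rw [abs_le] at hx hy hxy ⊢
  constructor <;> linarith

/-- In dimension at least three the oscillation is bounded by the energy, uniformly in the size of
the box: the contributions of the scales are summable. -/
lemma sq_sub_le_of_three_le {d N : ℕ} (hd : 3 ≤ d) (f : Site d N → ℝ) (x y : Site d N) :
    (f x - f y) ^ 2 ≤ (9 * d) ^ 2 * edgeEnergy d N f := by
  have hE := edgeEnergy_nonneg f
  have hr : ∀ j : ℕ, (2 : ℝ) ^ j * √(edgeEnergy d N f / ((2 : ℝ) ^ j) ^ d) ≤
      (3 / 4 : ℝ) ^ j * √(edgeEnergy d N f) := by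
    intro j
    rw [Real.sqrt_div hE, mul_div_assoc', div_le_iff₀ (by positivity), mul_comm, mul_right_comm,
      mul_comm _ √(edgeEnergy d N f)]
    refine mul_le_mul_of_nonneg_left ?_ (by positivity)
    have h1 : ((4 / 3 : ℝ) ^ j * 2 ^ j) ≤ √(((2 : ℝ) ^ j) ^ d) := by
      refine Real.le_sqrt_of_sq_le ?_
      calc ((4 / 3 : ℝ) ^ j * 2 ^ j) ^ 2 = (64 / 9 : ℝ) ^ j := by
            rw [← mul_pow, ← pow_mul, mul_comm j 2, pow_mul]; norm_num
        _ ≤ 8 ^ j := by gcongr; norm_num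
        _ = ((2 : ℝ) ^ j) ^ 3 := by rw [← pow_mul, mul_comm j 3, pow_mul]; norm_num
        _ ≤ ((2 : ℝ) ^ j) ^ d := pow_le_pow_right₀ (one_le_pow₀ (by norm_num)) hd
    calc (2 : ℝ) ^ j = (3 / 4) ^ j * ((4 / 3 : ℝ) ^ j * 2 ^ j) := by
          rw [← mul_assoc, ← mul_pow]; norm_num
      _ ≤ _ := by gcongr
  have h := abs_sub_le_sum_scales f x y hr
  have hgeom : ∀ n : ℕ, ∑ j ∈ Finset.range n, (3 / 4 : ℝ) ^ j ≤ 4 := by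
    intro n
    rw [geom_sum_eq (by norm_num)]
    have : (0 : ℝ) ≤ (3 / 4) ^ n := by positivity
    rw [div_le_iff_of_neg (by norm_num)]
    linarith
  have hone : ∀ n : ℕ, (3 / 4 : ℝ) ^ n ≤ 1 := fun n => pow_le_one₀ (by norm_num) (by norm_num)
  have h2 : |f x - f y| ≤ 9 * d * √(edgeEnergy d N f) := by
    refine h.trans (mul_le_mul_of_nonneg_right ?_ (by positivity))
    have := hgeom (Nat.log 2 (2 * N + 1))
    have := hone (Nat.log 2 (2 * N + 1))
    have hd0 : (0 : ℝ) ≤ d := by positivity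
    nlinarith
  calc (f x - f y) ^ 2 = |f x - f y| ^ 2 := (sq_abs _).symm
    _ ≤ (9 * d * √(edgeEnergy d N f)) ^ 2 := by gcongr
    _ = _ := by rw [mul_pow, Real.sq_sqrt hE]

/-- In dimension two all scales contribute equally, whence a factor `(log N) ^ 2`. -/
lemma sq_sub_le_of_two {N : ℕ} (f : Site 2 N → ℝ) (x y : Site 2 N) :
    (f x - f y) ^ 2 ≤ (4 * Nat.log 2 (2 * N + 1) + 2) ^ 2 * edgeEnergy 2 N f := by
  have hE := edgeEnergy_nonneg f
  have hr : ∀ j : ℕ, (2 : ℝ) ^ j * √(edgeEnergy 2 N f / ((2 : ℝ) ^ j) ^ 2) ≤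
      (1 : ℝ) ^ j * √(edgeEnergy 2 N f) := by
    intro j
    rw [Real.sqrt_div hE, Real.sqrt_sq (by positivity), mul_div_cancel₀ _ (by positivity)]
    simp
  have h := abs_sub_le_sum_scales f x y hr
  simp only [one_pow, Finset.sum_const, Finset.card_range, nsmul_eq_mul, mul_one] at h
  calc (f x - f y) ^ 2 = |f x - f y| ^ 2 := (sq_abs _).symm
    _ ≤ ((4 * Nat.log 2 (2 * N + 1) + 2) * √(edgeEnergy 2 N f)) ^ 2 := by
        gcongr
        refine h.trans (le_of_eq ?_)
        push_cast
        ring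
    _ = _ := by rw [mul_pow, Real.sq_sqrt hE]

/-! ### Spectral decomposition of the Laplacian -/

lemma sum_eigenfun_mul_eigenfun (d N : ℕ) (k l : Site d N) :
    ∑ x, eigenfun d N k x * eigenfun d N l x = if k = l then 1 else 0 := by
  have h := orthonormal_iff_ite.1 (negLaplacian_isHermitian d N).eigenvectorBasis.orthonormal k l
  rw [← h, PiLp.inner_apply]
  refine Finset.sum_congr rfl fun x _ => ?_
  simp [eigenfun, mul_comm]

lemma sum_eigenfun_apply_mul (d N : ℕ) (x y : Site d N) :
    ∑ k, eigenfun d N k x * eigenfun d N k y = if x = y then 1 else 0 := by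
  have h := Matrix.mem_unitaryGroup_iff.1 (negLaplacian_isHermitian d N).eigenvectorUnitary.2
  have h2 := congrFun (congrFun h x) y
  rw [Matrix.mul_apply, Matrix.one_apply] at h2
  rw [← h2]
  refine Finset.sum_congr rfl fun k _ => ?_
  simp [eigenfun, Matrix.star_apply]

lemma negLaplacian_mulVec_eigenfun (d N : ℕ) (k : Site d N) :
    (negLaplacian d N).mulVec (eigenfun d N k) = lam d N k • eigenfun d N k :=
  (negLaplacian_isHermitian d N).mulVec_eigenvectorBasis k

lemma edgeEnergy_eq_dotProduct {d N : ℕ} (f : Site d N → ℝ) :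
    edgeEnergy d N f = 2 * (f ⬝ᵥ (negLaplacian d N).mulVec f) := by
  have h := SimpleGraph.lapMatrix_toLinearMap₂' (G := boxGraph d N) ℝ f
  rw [Matrix.toLinearMap₂'_apply'] at h
  rw [negLaplacian, h, edgeEnergy]
  ring

lemma edgeEnergy_sum_eigenfun {d N : ℕ} (a : Site d N → ℝ) :
    edgeEnergy d N (fun x => ∑ k, a k * eigenfun d N k x) = 2 * ∑ k, lam d N k * a k ^ 2 := by
  have hf : (fun x => ∑ k, a k * eigenfun d N k x) = ∑ k, a k • eigenfun d N k := by
    funext x; simp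
  rw [edgeEnergy_eq_dotProduct, hf, Matrix.mulVec_sum, sum_dotProduct]
  congr 1
  refine Finset.sum_congr rfl fun k _ => ?_
  rw [dotProduct_sum, Finset.sum_eq_single k]
  · rw [Matrix.mulVec_smul, negLaplacian_mulVec_eigenfun, smul_dotProduct, dotProduct_smul,
      dotProduct_smul, dotProduct, sum_eigenfun_mul_eigenfun]
    simp
    ring
  · intro l _ hl
    rw [Matrix.mulVec_smul, negLaplacian_mulVec_eigenfun, smul_dotProduct, dotProduct_smul,
      dotProduct_smul, dotProduct, sum_eigenfun_mul_eigenfun, if_neg hl.symm]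
    simp
  · simp

/-- The coefficient of `f` in the eigenbasis. -/
def coeff {d N : ℕ} (f : Site d N → ℝ) (k : Site d N) : ℝ := ∑ x, f x * eigenfun d N k x

lemma sum_coeff_mul_eigenfun {d N : ℕ} (f : Site d N → ℝ) (x : Site d N) :
    ∑ k, coeff f k * eigenfun d N k x = f x := by
  simp only [coeff, Finset.sum_mul]
  rw [Finset.sum_comm]
  simp_rw [mul_assoc, ← Finset.mul_sum, sum_eigenfun_apply_mul]
  simp

lemma edgeEnergy_eq_sum_coeff {d N : ℕ} (f : Site d N → ℝ) :
    edgeEnergy d N f = 2 * ∑ k, lam d N k * coeff f k ^ 2 := by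
  rw [← edgeEnergy_sum_eigenfun]
  congr 1
  funext x
  rw [sum_coeff_mul_eigenfun]

lemma edgeEnergy_eigenfun (d N : ℕ) (k : Site d N) :
    edgeEnergy d N (eigenfun d N k) = 2 * lam d N k := by
  rw [edgeEnergy_eq_dotProduct, negLaplacian_mulVec_eigenfun, dotProduct_smul, dotProduct,
    sum_eigenfun_mul_eigenfun]
  simp

lemma lam_nonneg (d N : ℕ) (k : Site d N) : 0 ≤ lam d N k := by
  have h := edgeEnergy_nonneg (eigenfun d N k)
  rw [edgeEnergy_eigenfun] at h
  linarith

lemma lam_pos {d N : ℕ} (k : Mode d N) : 0 < lam d N k :=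
  lt_of_le_of_ne (lam_nonneg d N k) (Ne.symm k.2)

/-- A crude bound on the degree of a site. -/
lemma card_adj_le {d N : ℕ} (x : Site d N) :
    ∑ y, (if (boxGraph d N).Adj x y then (1 : ℝ) else 0) ≤ 3 ^ d := by
  rw [Finset.sum_boole]
  have : (Finset.univ.filter fun y => (boxGraph d N).Adj x y).card ≤
      (Fintype.piFinset fun _ : Fin d => Finset.Icc (-1 : ℤ) 1).card := by
    refine Finset.card_le_card_of_injOn (fun y i => (y i : ℤ) - x i) ?_ ?_
    · intro y hy
      have hy' : ∑ i, |(x i : ℤ) - y i| = 1 := (Finset.mem_filter.1 hy).2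
      simp only [Fintype.coe_piFinset, Set.mem_pi, Set.mem_univ, forall_const]
      intro i
      have := Finset.single_le_sum (f := fun i => |(x i : ℤ) - y i|)
        (fun i _ => abs_nonneg _) (Finset.mem_univ i)
      rw [hy', abs_le] at this
      rw [Finset.coe_Icc, Set.mem_Icc]
      constructor <;> linarith
    · intro y _ z _ hyz
      funext i
      have := congrFun hyz i
      exact Subtype.ext (by simpa using this)
  calc _ ≤ (((Fintype.piFinset fun _ : Fin d => Finset.Icc (-1 : ℤ) 1).card : ℕ) : ℝ) := by
        exact_mod_cast this
    _ = _ := by simp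

lemma lam_le (d N : ℕ) (k : Site d N) : lam d N k ≤ 2 * 3 ^ d := by
  have h := edgeEnergy_eigenfun d N k
  set φ := eigenfun d N k
  have h1 : ∑ x, φ x ^ 2 = 1 := by
    have := sum_eigenfun_mul_eigenfun d N k k
    simpa [sq] using this
  have h2 : ∑ x, ∑ y, (if (boxGraph d N).Adj x y then φ x ^ 2 else 0) ≤ 3 ^ d := by
    calc _ = ∑ x, φ x ^ 2 * ∑ y, (if (boxGraph d N).Adj x y then (1 : ℝ) else 0) := by
          simp only [Finset.mul_sum, mul_ite, mul_one, mul_zero]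
      _ ≤ ∑ x, φ x ^ 2 * 3 ^ d := Finset.sum_le_sum fun x _ =>
          mul_le_mul_of_nonneg_left (card_adj_le x) (sq_nonneg _)
      _ = _ := by rw [← Finset.sum_mul, h1, one_mul]
  have h3 : ∑ x, ∑ y, (if (boxGraph d N).Adj x y then φ y ^ 2 else 0) ≤ 3 ^ d := by
    rw [Finset.sum_comm]
    refine le_trans (le_of_eq ?_) h2
    refine Finset.sum_congr rfl fun x _ => Finset.sum_congr rfl fun y _ => ?_
    exact if_congr (SimpleGraph.adj_comm _ _ _) rfl rfl
  have h4 : edgeEnergy d N φ ≤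
      2 * ∑ x, ∑ y, (if (boxGraph d N).Adj x y then φ x ^ 2 else 0)
      + 2 * ∑ x, ∑ y, (if (boxGraph d N).Adj x y then φ y ^ 2 else 0) := by
    simp only [edgeEnergy, Finset.mul_sum, ← Finset.sum_add_distrib]
    refine Finset.sum_le_sum fun x _ => Finset.sum_le_sum fun y _ => ?_
    split_ifs
    · nlinarith [sq_nonneg (φ x + φ y)]
    · simp
  linarith

lemma card_site (d N : ℕ) : (Fintype.card (Site d N) : ℝ) = (2 * N + 1) ^ d := by
  have h : (Int.toNat ((N : ℤ) + 1 + (N : ℤ))) = 2 * N + 1 := by omega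
  simp [h]

lemma edgeEnergy_coordinate_le {d N : ℕ} (a : ℝ) (i : Fin d) :
    edgeEnergy d N (fun x => a * ((x i : ℤ) : ℝ)) ≤ a ^ 2 * 3 ^ d * (2 * N + 1) ^ d := by
  calc edgeEnergy d N (fun x => a * ((x i : ℤ) : ℝ))
      ≤ ∑ x : Site d N, ∑ y, a ^ 2 * (if (boxGraph d N).Adj x y then (1 : ℝ) else 0) := by
        refine Finset.sum_le_sum fun x _ => Finset.sum_le_sum fun y _ => ?_
        split_ifs with h
        · have h' : ∑ i, |(x i : ℤ) - y i| = 1 := h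
          have := Finset.single_le_sum (f := fun i => |(x i : ℤ) - y i|)
            (fun i _ => abs_nonneg _) (Finset.mem_univ i)
          rw [h'] at this
          have h2 : |((x i : ℤ) : ℝ) - ((y i : ℤ) : ℝ)| ≤ 1 := by exact_mod_cast this
          have h3 : (((x i : ℤ) : ℝ) - ((y i : ℤ) : ℝ)) ^ 2 ≤ 1 := by
            rw [← sq_abs]; exact pow_le_one₀ (abs_nonneg _) h2
          rw [← mul_sub, mul_pow]
          exact mul_le_mul_of_nonneg_left h3 (sq_nonneg _)
        · simp
    _ ≤ ∑ x : Site d N, a ^ 2 * 3 ^ d := by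
        refine Finset.sum_le_sum fun x _ => ?_
        rw [← Finset.mul_sum]
        exact mul_le_mul_of_nonneg_left (card_adj_le x) (sq_nonneg _)
    _ = _ := by
        rw [Finset.sum_const, Finset.card_univ, nsmul_eq_mul, card_site]
        ring

/-- The increment of the eigenfunction `k` between two sites. -/
def incr {d N : ℕ} (x y : Site d N) (k : Site d N) : ℝ := eigenfun d N k x - eigenfun d N k y

/-- The effective resistance between two sites; the increment of a component of the free field
between them has variance `(2 β)⁻¹ * resistance x y`. -/
def resistance {d N : ℕ} (x y : Site d N) : ℝ := ∑ k : Mode d N, incr x y k ^ 2 / lam d N k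

lemma sum_mode {d N : ℕ} (g : Site d N → ℝ) (hg : ∀ k, lam d N k = 0 → g k = 0) :
    ∑ k : Mode d N, g k = ∑ k, g k := by
  rw [← Finset.sum_subtype (Finset.univ.filter fun k => lam d N k ≠ 0)
    (p := fun k => lam d N k ≠ 0) (by simp) g, Finset.sum_filter_of_ne]
  intro k _ hk h0
  exact hk (hg k h0)

/-- Thomson's principle: a bound of the increment by the energy is a bound of the resistance. -/
lemma resistance_le {d N : ℕ} {x y : Site d N} {C : ℝ} (hC : 0 ≤ C)
    (h : ∀ f : Site d N → ℝ, (f x - f y) ^ 2 ≤ C * edgeEnergy d N f) :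
    resistance x y ≤ 2 * C := by
  -- the bound is applied to the potential of a unit current from `x` to `y`
  set a : Site d N → ℝ := fun k => incr x y k / lam d N k with ha
  have hR : resistance x y = ∑ k, incr x y k ^ 2 / lam d N k :=
    sum_mode (fun k => incr x y k ^ 2 / lam d N k) fun k hk => by simp [hk]
  have h1 := h fun z => ∑ k, a k * eigenfun d N k z
  have h2 : edgeEnergy d N (fun z => ∑ k, a k * eigenfun d N k z) = 2 * resistance x y := by
    rw [edgeEnergy_sum_eigenfun, hR]
    congr 1
    refine Finset.sum_congr rfl fun k _ => ?_
    rcases eq_or_ne (lam d N k) 0 with h0 | h0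
    · simp [h0]
    · rw [ha]; field_simp
  have h3 : ∑ k, a k * eigenfun d N k x - ∑ k, a k * eigenfun d N k y = resistance x y := by
    rw [hR, ← Finset.sum_sub_distrib]
    refine Finset.sum_congr rfl fun k _ => ?_
    rw [ha, ← mul_sub]
    change incr x y k / lam d N k * incr x y k = _
    ring
  simp only [h2, h3] at h1
  by_contra hlt
  nlinarith

/-- The resistance in dimension at least three is bounded uniformly in the size of the box. -/
lemma resistance_le_of_three_le {d N : ℕ} (hd : 3 ≤ d) (x y : Site d N) :
    resistance x y ≤ 2 * (9 * d) ^ 2 :=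
  resistance_le (by positivity) fun f => sq_sub_le_of_three_le hd f x y

lemma resistance_le_of_two {N : ℕ} (x y : Site 2 N) :
    resistance x y ≤ 2 * (4 * Nat.log 2 (2 * N + 1) + 2) ^ 2 :=
  resistance_le (by positivity) fun f => sq_sub_le_of_two f x y

/-- The box is connected: the eigenfunctions of the eigenvalue zero are constant. -/
lemma incr_eq_zero {d N : ℕ} (hd : 2 ≤ d) (x y : Site d N) {k : Site d N} (hk : lam d N k = 0) :
    incr x y k = 0 := by
  have hE := edgeEnergy_eigenfun d N k
  rw [hk, mul_zero] at hE
  have h : (eigenfun d N k x - eigenfun d N k y) ^ 2 ≤ 0 := by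
    rcases hd.eq_or_lt with rfl | hd
    · simpa [hE] using sq_sub_le_of_two (eigenfun 2 N k) x y
    · simpa [hE] using sq_sub_le_of_three_le hd (eigenfun d N k) x y
  exact pow_eq_zero_iff (two_ne_zero) |>.1 (le_antisymm h (sq_nonneg _))

lemma sum_incr_sq {d N : ℕ} (hd : 2 ≤ d) {x y : Site d N} (hxy : x ≠ y) :
    ∑ k : Mode d N, incr x y k ^ 2 = 2 := by
  rw [sum_mode (fun k => incr x y k ^ 2) fun k hk => by simp [incr_eq_zero hd x y hk]]
  have : ∀ k, incr x y k ^ 2 = eigenfun d N k x * eigenfun d N k x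
      - 2 * (eigenfun d N k x * eigenfun d N k y) + eigenfun d N k y * eigenfun d N k y := by
    intro k; rw [incr]; ring
  simp_rw [this]
  rw [Finset.sum_add_distrib, Finset.sum_sub_distrib, ← Finset.mul_sum]
  simp only [sum_eigenfun_apply_mul, if_neg hxy, if_true]
  norm_num

lemma sum_coeff_mul_incr {d N : ℕ} (hd : 2 ≤ d) (f : Site d N → ℝ) (x y : Site d N) :
    ∑ k : Mode d N, coeff f k * incr x y k = f x - f y := by
  rw [sum_mode (fun k => coeff f k * incr x y k) fun k hk => by simp [incr_eq_zero hd x y hk]]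
  simp only [incr, mul_sub, Finset.sum_sub_distrib, sum_coeff_mul_eigenfun]

lemma resistance_nonneg {d N : ℕ} (x y : Site d N) : 0 ≤ resistance x y :=
  Finset.sum_nonneg fun k _ => div_nonneg (sq_nonneg _) (lam_nonneg d N k)

/-- Distinct sites have a resistance bounded below, as the eigenvalues are bounded above. -/
lemma le_resistance {d N : ℕ} (hd : 2 ≤ d) {x y : Site d N} (hxy : x ≠ y) :
    1 / 3 ^ d ≤ resistance x y := by
  calc (1 : ℝ) / 3 ^ d = ∑ k : Mode d N, incr x y k ^ 2 / (2 * 3 ^ d) := by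
        rw [← Finset.sum_div, sum_incr_sq hd hxy]
        field_simp
    _ ≤ _ := Finset.sum_le_sum fun k _ =>
        div_le_div_of_nonneg_left (sq_nonneg _) (lam_pos k) (lam_le d N k)

lemma sum_lam_mul_coeff_sq {d N : ℕ} (f : Site d N → ℝ) :
    ∑ k : Mode d N, lam d N k * coeff f k ^ 2 = edgeEnergy d N f / 2 := by
  rw [sum_mode (fun k => lam d N k * coeff f k ^ 2) fun k hk => by simp [hk],
    edgeEnergy_eq_sum_coeff]
  ring

lemma sum_lam_le (d N : ℕ) : ∑ k : Mode d N, lam d N k ≤ 2 * 3 ^ d * (2 * N + 1) ^ d := by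
  rw [sum_mode (fun k => lam d N k) fun k hk => hk, ← card_site]
  calc ∑ k, lam d N k ≤ ∑ _k : Site d N, (2 * 3 ^ d : ℝ) :=
        Finset.sum_le_sum fun k _ => lam_le d N k
    _ = _ := by rw [Finset.sum_const, Finset.card_univ, nsmul_eq_mul, mul_comm]

/-! ### Linear functionals of independent Gaussian variables -/

/-- A linear combination of independent Gaussian variables is Gaussian. -/
lemma pi_gaussianReal_map_sum {κ : Type*} [Fintype κ] (m : κ → ℝ) (v : κ → ℝ≥0) (c : κ → ℝ) :
    (Measure.pi fun k => gaussianReal (m k) (v k)).map (fun X => ∑ k, X k * c k) =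
      gaussianReal (∑ k, m k * c k) (∑ k, v k * (c k ^ 2).toNNReal) := by
  have hind : iIndepFun (fun k (X : κ → ℝ) => X k * c k)
      (Measure.pi fun k => gaussianReal (m k) (v k)) :=
    iIndepFun_pi (X := fun k x => x * c k) fun k => by fun_prop
  have hm : Measurable fun X : κ → ℝ => ∑ k, X k * c k := by fun_prop
  have hmk : ∀ k, Measurable fun X : κ → ℝ => X k * c k := fun k => by fun_prop
  have : IsProbabilityMeasure ((Measure.pi fun k => gaussianReal (m k) (v k)).map
      (fun X => ∑ k, X k * c k)) := Measure.isProbabilityMeasure_map hm.aemeasurable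
  apply Measure.ext_of_charFun
  rw [hind.charFun_map_fun_sum_eq_prod fun k => (hmk k).aemeasurable]
  funext t
  rw [Finset.prod_apply]
  have h1 : ∀ k, (Measure.pi fun k => gaussianReal (m k) (v k)).map (fun X => X k * c k) =
      gaussianReal (c k * m k) ((c k ^ 2).toNNReal * v k) := by
    intro k
    have hc : (c k ^ 2).toNNReal = NNReal.mk (c k ^ 2) (sq_nonneg _) :=
      Real.toNNReal_of_nonneg (sq_nonneg _)
    rw [hc, ← gaussianReal_map_mul_const, ← (measurePreserving_eval
      (fun k => gaussianReal (m k) (v k)) k).map_eq, Measure.map_map (by fun_prop) (by fun_prop)]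
    rfl
  simp_rw [h1, charFun_gaussianReal]
  rw [← Complex.exp_sum]
  congr 1
  push_cast
  rw [Finset.mul_sum, Finset.sum_mul, Finset.sum_mul, Finset.sum_div, ← Finset.sum_sub_distrib]
  refine Finset.sum_congr rfl fun k _ => ?_
  ring

/-- The components of a vector valued Gaussian field are independent. -/
lemma pi_gaussianReal_forall_mem {ι κ : Type*} [Fintype ι] [Fintype κ] (m : ι × κ → ℝ)
    (v : ι × κ → ℝ≥0) (c : κ → ℝ) {S : Set ℝ} (hS : MeasurableSet S) :
    (Measure.pi fun p => gaussianReal (m p) (v p)) {X | ∀ i, ∑ k, X (i, k) * c k ∈ S} =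
      ∏ i, gaussianReal (∑ k, m (i, k) * c k) (∑ k, v (i, k) * (c k ^ 2).toNNReal) S := by
  have h := Measure.infinitePi_map_curry (fun i k => gaussianReal (m (i, k)) (v (i, k)))
  simp only [Measure.infinitePi_eq_pi, Prod.mk.eta] at h
  have hset : {X : ι × κ → ℝ | ∀ i, ∑ k, X (i, k) * c k ∈ S} =
      (MeasurableEquiv.curry ι κ ℝ) ⁻¹'
        (Set.pi Set.univ fun _ => {Y : κ → ℝ | ∑ k, Y k * c k ∈ S}) := by
    ext X
    simp [MeasurableEquiv.curry, Function.curry]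
  have hmeas : Measurable fun Y : κ → ℝ => ∑ k, Y k * c k := by fun_prop
  have hmS : MeasurableSet {Y : κ → ℝ | ∑ k, Y k * c k ∈ S} := hmeas hS
  rw [hset, ← Measure.map_apply (MeasurableEquiv.measurable _)
    (MeasurableSet.univ_pi fun _ => hmS), h, Measure.pi_pi]
  refine Finset.prod_congr rfl fun i _ => ?_
  rw [← pi_gaussianReal_map_sum (fun k => m (i, k)) (fun k => v (i, k)) c,
    Measure.map_apply hmeas hS]
  rfl

/-- Gaussian tail bound. -/
lemma gaussianReal_abs_ge_le (v : ℝ≥0) {s r : ℝ} (hr : 0 ≤ r) (hs : 0 < s) (hv : (v : ℝ) ≤ s) :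
    gaussianReal 0 v {x | r ≤ |x|} ≤ ENNReal.ofReal (2 * Real.exp (-r ^ 2 / (2 * s))) := by
  have hsub : HasSubgaussianMGF (fun x : ℝ => x) s.toNNReal (gaussianReal 0 v) := by
    constructor
    · intro t
      exact integrable_exp_mul_gaussianReal t
    · intro t
      rw [mgf_fun_id_gaussianReal, Real.coe_toNNReal _ hs.le]
      refine Real.exp_le_exp.2 ?_
      have : (v : ℝ) * t ^ 2 ≤ s * t ^ 2 := by gcongr
      linarith
  have h1 := hsub.measure_ge_le hr
  have h2 := hsub.neg.measure_ge_le hr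
  rw [Real.coe_toNNReal _ hs.le] at h1 h2
  have h3 : {x : ℝ | r ≤ |x|} ⊆ {x | r ≤ x} ∪ {x | r ≤ (-fun x : ℝ => x) x} := by
    intro x hx
    exact le_abs.1 (show r ≤ |x| from hx)
  refine (measure_mono h3).trans ((measure_union_le _ _).trans ?_)
  rw [two_mul, ENNReal.ofReal_add (by positivity) (by positivity)]
  refine add_le_add ?_ ?_
  · rw [← ENNReal.ofReal_toReal (measure_ne_top (gaussianReal 0 v) _)]
    exact ENNReal.ofReal_le_ofReal h1
  · rw [← ENNReal.ofReal_toReal (measure_ne_top (gaussianReal 0 v) _)]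
    exact ENNReal.ofReal_le_ofReal h2

/-! ### Hitting probabilities of unit intervals -/

/-- An upper bound for the probability that a Gaussian variable with mean `a * t` and variance
between `w₀` and `M * w₀` lies in `[-1, 1]`. It decays only quadratically in `t`, which suffices for
summation. The truncated subtraction `|t| - 1` is the distance of `t` from `[-1, 1]`. -/
def hitBound (a w₀ M : ℝ) (t : ℤ) : ℝ :=
  4 / √w₀ * (1 / (1 + a / √(2 * M * w₀) * ((t.natAbs - 1 : ℕ) : ℝ)) ^ 2)

lemma hitBound_nonneg (a w₀ M : ℝ) (t : ℤ) : 0 ≤ hitBound a w₀ M t := by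
  unfold hitBound; positivity

lemma exp_neg_sq_le {s : ℝ} (hs : 0 ≤ s) : Real.exp (-s ^ 2) ≤ 2 * (1 / (1 + s) ^ 2) := by
  rw [Real.exp_neg, ← one_div, mul_one_div, div_le_div_iff₀ (by positivity) (by positivity)]
  have := Real.add_one_le_exp (s ^ 2)
  nlinarith [sq_nonneg (1 - s)]

lemma gaussianReal_Icc_le {a w₀ M : ℝ} (ha : 1 ≤ a) (hw₀ : 0 < w₀) (hM : 0 < M) {w : ℝ≥0}
    (h₁ : w₀ ≤ w) (h₂ : (w : ℝ) ≤ M * w₀) (t : ℤ) :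
    gaussianReal (a * t) w (Set.Icc (-1) 1) ≤ ENNReal.ofReal (hitBound a w₀ M t) := by
  have hwpos : (0 : ℝ) < w := hw₀.trans_le h₁
  have hw : w ≠ 0 := by rintro rfl; simp at hwpos
  have hu : (0 : ℝ) ≤ ((t.natAbs - 1 : ℕ) : ℝ) := by positivity
  have hut : |(t : ℝ)| ≤ ((t.natAbs - 1 : ℕ) : ℝ) + 1 := by
    rw [← Int.cast_abs, Int.abs_eq_natAbs]
    have : t.natAbs ≤ (t.natAbs - 1) + 1 := by omega
    exact_mod_cast this
  have htu : ((t.natAbs - 1 : ℕ) : ℝ) = 0 ∨ ((t.natAbs - 1 : ℕ) : ℝ) + 1 = |(t : ℝ)| := by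
    rcases Nat.eq_zero_or_pos t.natAbs with h | h
    · left; simp [h]
    · right
      rw [← Int.cast_abs, Int.abs_eq_natAbs]
      have : (t.natAbs - 1) + 1 = t.natAbs := by omega
      exact_mod_cast this
  have hhit : hitBound a w₀ M t =
    4 / √w₀ * (1 / (1 + a / √(2 * M * w₀) * ((t.natAbs - 1 : ℕ) : ℝ)) ^ 2) := rfl
  generalize ((t.natAbs - 1 : ℕ) : ℝ) = u at *
  have hpdf : ∀ y ∈ Set.Icc (-1 : ℝ) 1, gaussianPDF (a * t) w y ≤
      ENNReal.ofReal (hitBound a w₀ M t / 2) := by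
    intro y hy
    rw [gaussianPDF]
    refine ENNReal.ofReal_le_ofReal ?_
    have hdist : (a * u) ^ 2 ≤ (y - a * t) ^ 2 := by
      rcases htu with h | h
      · rw [h, mul_zero, zero_pow two_ne_zero]; positivity
      · rw [← sq_abs (y - a * t)]
        refine pow_le_pow_left₀ (by positivity) ?_ 2
        have h1 : |a * t| ≤ |y - a * t| + |y| := by
          have := abs_sub_abs_le_abs_sub (a * t) y
          rw [abs_sub_comm] at this
          linarith
        have h2 : |y| ≤ 1 := abs_le.2 hy
        rw [abs_mul, abs_of_pos (by linarith : 0 < a), ← h] at h1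
        nlinarith
    set σ := a / √(2 * M * w₀) * u with hσ
    have hσ0 : 0 ≤ σ := by positivity
    have hexp : -(y - a * t) ^ 2 / (2 * w) ≤ -σ ^ 2 := by
      rw [neg_div, neg_le_neg_iff, hσ, div_mul_eq_mul_div, div_pow, Real.sq_sqrt (by positivity)]
      calc (a * u) ^ 2 / (2 * M * w₀) ≤ (y - a * t) ^ 2 / (2 * M * w₀) := by gcongr
        _ ≤ _ := by
          refine div_le_div_of_nonneg_left (sq_nonneg _) (by positivity) ?_
          linarith
    have hsq : (√(2 * Real.pi * w))⁻¹ ≤ (√w₀)⁻¹ := by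
      refine inv_anti₀ (by positivity) (Real.sqrt_le_sqrt ?_)
      have := Real.pi_gt_three
      nlinarith
    rw [gaussianPDFReal, hhit]
    calc _ ≤ (√w₀)⁻¹ * Real.exp (-σ ^ 2) := by gcongr
      _ ≤ (√w₀)⁻¹ * (2 * (1 / (1 + σ) ^ 2)) := by gcongr; exact exp_neg_sq_le hσ0
      _ = _ := by ring
  rw [gaussianReal_apply _ hw]
  calc _ ≤ ∫⁻ _ in Set.Icc (-1 : ℝ) 1, ENNReal.ofReal (hitBound a w₀ M t / 2) :=
        setLIntegral_mono measurable_const hpdf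
    _ = ENNReal.ofReal (hitBound a w₀ M t) := by
        rw [setLIntegral_const, Real.volume_Icc, ← ENNReal.ofReal_mul
          (by have := hitBound_nonneg a w₀ M t; positivity)]
        congr 1
        ring

lemma sum_range_inv_sq_le {b : ℝ} (hb : 0 < b) (n : ℕ) :
    ∑ j ∈ Finset.range n, 1 / (1 + b * (j : ℝ)) ^ 2 ≤ 1 + 1 / b := by
  -- the sum telescopes after replacing one factor by its predecessor
  have key : ∀ n : ℕ, ∑ j ∈ Finset.range (n + 1), 1 / (1 + b * (j : ℝ)) ^ 2 ≤
      1 + 1 / b - 1 / b * (1 / (1 + b * n)) := by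
    intro n
    induction n with
    | zero => simp
    | succ n ih =>
      rw [Finset.sum_range_succ]
      have h1 : (0 : ℝ) < 1 + b * n := by positivity
      have h2 : (0 : ℝ) < 1 + b * (n + 1) := by positivity
      have : 1 / (1 + b * ((n : ℝ) + 1)) ^ 2 ≤
          1 / b * (1 / (1 + b * n)) - 1 / b * (1 / (1 + b * (n + 1))) := by
        have : 1 / b * (1 / (1 + b * n)) - 1 / b * (1 / (1 + b * (n + 1))) =
            1 / ((1 + b * n) * (1 + b * (n + 1))) := by field_simp; ring
        rw [this, sq]
        refine one_div_le_one_div_of_le (by positivity) ?_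
        nlinarith
      push_cast
      linarith
  rcases n with _ | n
  · simp; positivity
  · refine (key n).trans ?_
    have : (0 : ℝ) ≤ 1 / b * (1 / (1 + b * n)) := by positivity
    linarith

lemma sum_Icc_natAbs_le (g : ℕ → ℝ) (hg : ∀ j, 0 ≤ g j) (n : ℕ) :
    ∑ t ∈ Finset.Icc (-(n : ℤ)) n, g t.natAbs ≤ 2 * ∑ j ∈ Finset.range (n + 1), g j := by
  induction n with
  | zero => simp; linarith [hg 0]
  | succ n ih =>
    have : Finset.Icc (-((n + 1 : ℕ) : ℤ)) ((n + 1 : ℕ) : ℤ) =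
        insert (((n + 1 : ℕ) : ℤ)) (insert (-((n + 1 : ℕ) : ℤ)) (Finset.Icc (-(n : ℤ)) n)) := by
      ext t
      simp only [Finset.mem_Icc, Finset.mem_insert]
      push_cast
      omega
    rw [this, Finset.sum_insert, Finset.sum_insert, Finset.sum_range_succ, Int.natAbs_neg,
      Int.natAbs_natCast]
    · linarith
    · simp
    · simp only [Finset.mem_insert, Finset.mem_Icc]; push_cast; omega

/-- Summing over the possible values of one coordinate: the number of sites of a line that are
mapped to a given unit interval is of the order of the inverse slope. -/
lemma sum_hitBound_le {a w₀ M : ℝ} (ha : 1 ≤ a) (hw₀ : a ^ 2 ≤ w₀) (hM : 1 ≤ M) {N : ℕ}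
    {z : ℤ} (hz : z ∈ Finset.Icc (-(N : ℤ)) N) :
    ∑ t ∈ Finset.Icc (-(N : ℤ)) N, hitBound a w₀ M (z - t) ≤ (24 + 16 * M) / a := by
  have ha0 : 0 < a := by linarith
  have hw : 0 < w₀ := lt_of_lt_of_le (by positivity) hw₀
  set b := a / √(2 * M * w₀) with hb
  have hb0 : 0 < b := by positivity
  set g : ℕ → ℝ := fun j => 4 / √w₀ * (1 / (1 + b * ((j - 1 : ℕ) : ℝ)) ^ 2) with hg
  have hg0 : ∀ j, 0 ≤ g j := fun j => by rw [hg]; positivity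
  have h1 : ∑ t ∈ Finset.Icc (-(N : ℤ)) N, hitBound a w₀ M (z - t) ≤
      ∑ t ∈ Finset.Icc (-((2 * N : ℕ) : ℤ)) ((2 * N : ℕ) : ℤ), g t.natAbs := by
    rw [Finset.mem_Icc] at hz
    have hinj : Set.InjOn (fun t : ℤ => z - t) (Finset.Icc (-(N : ℤ)) (N : ℤ)) := by
      intro s _ t _ h
      dsimp only at h
      omega
    rw [show ∑ t ∈ Finset.Icc (-(N : ℤ)) N, hitBound a w₀ M (z - t) =
      ∑ t ∈ (Finset.Icc (-(N : ℤ)) (N : ℤ)).image (fun t => z - t), g t.natAbs by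
        rw [Finset.sum_image hinj]; rfl]
    refine Finset.sum_le_sum_of_subset_of_nonneg ?_ fun t _ _ => hg0 _
    intro t ht
    obtain ⟨s, hs, rfl⟩ := Finset.mem_image.1 ht
    rw [Finset.mem_Icc] at hs ⊢
    push_cast
    omega
  have h2 : ∑ j ∈ Finset.range (2 * N + 1), g j ≤ 4 / √w₀ * (2 + 1 / b) := by
    rw [Finset.sum_range_succ']
    simp only [hg, ← Finset.mul_sum, Nat.add_sub_cancel]
    have := sum_range_inv_sq_le hb0 (2 * N)
    have h4 : (0 : ℝ) ≤ 4 / √w₀ := by positivity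
    simp only [Nat.zero_sub, Nat.cast_zero, mul_zero, add_zero, one_pow, div_one, mul_one]
    nlinarith
  have hsa : a ≤ √w₀ := Real.le_sqrt_of_sq_le hw₀
  have h3 : 4 / √w₀ * (2 + 1 / b) ≤ (12 + 8 * M) / a := by
    have e1 : 4 / √w₀ * (2 + 1 / b) = 8 / √w₀ + 4 * √(2 * M) / a := by
      rw [hb, Real.sqrt_mul (by positivity) w₀]
      field_simp
      ring
    have e2 : 8 / √w₀ ≤ 8 / a := by gcongr
    have e3 : √(2 * M) ≤ 1 + 2 * M := by
      rw [Real.sqrt_le_left (by positivity)]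
      nlinarith
    have e4 : 4 * √(2 * M) / a ≤ 4 * (1 + 2 * M) / a := by gcongr
    calc _ ≤ 8 / a + 4 * (1 + 2 * M) / a := by linarith
      _ = _ := by ring
  calc _ ≤ _ := h1
    _ ≤ _ := sum_Icc_natAbs_le g hg0 (2 * N)
    _ ≤ 2 * ((12 + 8 * M) / a) := by linarith
    _ = _ := by ring

/-! ### Change of measure for Gaussian vectors -/

lemma ofReal_exp_neg_integral_le {Ω : Type*} [MeasurableSpace Ω] {μ : Measure Ω}
    [IsProbabilityMeasure μ] {K : Ω → ℝ} (hK : Integrable K μ) :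
    ENNReal.ofReal (Real.exp (-∫ ω, K ω ∂μ)) ≤ ∫⁻ ω, ENNReal.ofReal (Real.exp (-K ω)) ∂μ := by
  -- Jensen's inequality, from the tangent of the exponential function at the mean
  set m := ∫ ω, K ω ∂μ with hm
  have h1 : ∀ ω, Real.exp (-m) * (1 + m - K ω) ≤ Real.exp (-K ω) := by
    intro ω
    have : Real.exp (-K ω) = Real.exp (-m) * Real.exp (m - K ω) := by
      rw [← Real.exp_add]; congr 1; ring
    rw [this]
    gcongr
    have := Real.add_one_le_exp (m - K ω)
    linarith
  by_cases hfin : ∫⁻ ω, ENNReal.ofReal (Real.exp (-K ω)) ∂μ = ∞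
  · rw [hfin]; exact le_top
  have hint : Integrable (fun ω => Real.exp (-K ω)) μ := by
    refine (lintegral_ofReal_ne_top_iff_integrable ?_ ?_).1 hfin
    · exact (Real.measurable_exp.comp_aemeasurable
        hK.aestronglyMeasurable.aemeasurable.neg).aestronglyMeasurable
    · exact Eventually.of_forall fun ω => (Real.exp_pos _).le
  rw [← ofReal_integral_eq_lintegral_ofReal hint (Eventually.of_forall fun ω => (Real.exp_pos _).le)]
  refine ENNReal.ofReal_le_ofReal ?_
  have h2 : ∫ ω, Real.exp (-m) * (1 + m - K ω) ∂μ = Real.exp (-m) := by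
    rw [integral_const_mul, integral_sub (integrable_const _) hK, integral_const, ← hm]
    simp
  rw [← h2]
  exact integral_mono (((integrable_const _).sub hK).const_mul _) hint h1

lemma gaussianReal_zero_eq_withDensity (b : ℝ) {v w : ℝ≥0} (hv : v ≠ 0) (hw : w ≠ 0) :
    gaussianReal 0 v =
      (gaussianReal b w).withDensity fun x => gaussianPDF 0 v x / gaussianPDF b w x := by
  rw [gaussianReal_of_var_ne_zero _ hv, gaussianReal_of_var_ne_zero _ hw,
    ← withDensity_mul _ (measurable_gaussianPDF b w) (g := fun x => gaussianPDF 0 v x /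
      gaussianPDF b w x) ((measurable_gaussianPDF _ _).div (measurable_gaussianPDF _ _))]
  congr 1
  funext x
  exact (ENNReal.mul_div_cancel (gaussianPDF_pos b hw x).ne' gaussianPDF_ne_top).symm

lemma exp_le_gaussianPDF_div {b : ℝ} {v w : ℝ≥0} (hv : v ≠ 0) (hvw : v ≤ w) (x : ℝ) :
    ENNReal.ofReal (Real.exp (-(x ^ 2 / (2 * v) - (x - b) ^ 2 / (2 * w)))) ≤
      gaussianPDF 0 v x / gaussianPDF b w x := by
  have hv' : (0 : ℝ) < v := by positivity
  have hvw' : (v : ℝ) ≤ w := hvw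
  have hw' : (0 : ℝ) < w := hv'.trans_le hvw'
  have hw : w ≠ 0 := by rintro rfl; simp at hw'
  rw [ENNReal.le_div_iff_mul_le (Or.inl (gaussianPDF_pos b hw x).ne')
    (Or.inl gaussianPDF_ne_top), gaussianPDF, gaussianPDF, ← ENNReal.ofReal_mul (by positivity)]
  refine ENNReal.ofReal_le_ofReal ?_
  rw [gaussianPDFReal, gaussianPDFReal, mul_left_comm, ← Real.exp_add]
  have : (√(2 * Real.pi * w))⁻¹ ≤ (√(2 * Real.pi * v))⁻¹ := by gcongr
  refine mul_le_mul this (Real.exp_le_exp.2 (le_of_eq ?_)) (by positivity) (by positivity)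
  ring

lemma pi_eq_pi_withDensity {κ : Type*} [Fintype κ] {μ ν : κ → Measure ℝ}
    [∀ k, IsProbabilityMeasure (μ k)] [∀ k, IsProbabilityMeasure (ν k)] {r : κ → ℝ → ℝ≥0∞}
    (hr : ∀ k, Measurable (r k)) (h : ∀ k, μ k = (ν k).withDensity (r k)) :
    Measure.pi μ = (Measure.pi ν).withDensity fun x => ∏ k, r k (x k) := by
  refine Measure.pi_eq fun s hs => ?_
  rw [withDensity_apply _ (MeasurableSet.univ_pi hs), ← lintegral_indicator
    (MeasurableSet.univ_pi hs)]
  have h1 : ∀ x : κ → ℝ, (Set.univ.pi s).indicator (fun x => ∏ k, r k (x k)) x =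
      ∏ k, (s k).indicator (r k) (x k) := by
    intro x
    by_cases hx : x ∈ Set.univ.pi s
    · rw [Set.indicator_of_mem hx]
      exact Finset.prod_congr rfl fun k _ => (Set.indicator_of_mem (hx k (Set.mem_univ k)) _).symm
    · rw [Set.indicator_of_notMem hx]
      simp only [Set.mem_pi, Set.mem_univ, forall_const, not_forall] at hx
      obtain ⟨k, hk⟩ := hx
      exact (Finset.prod_eq_zero (Finset.mem_univ k) (Set.indicator_of_notMem hk _)).symm
  simp_rw [h1]
  rw [lintegral_prod_eq_prod_lintegral_of_indepFun Finset.univ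
    (fun k (x : κ → ℝ) => (s k).indicator (r k) (x k))
    (iIndepFun_pi fun k => ((hr k).indicator (hs k)).aemeasurable)
    fun k => ((hr k).indicator (hs k)).comp (measurable_pi_apply k)]
  refine Finset.prod_congr rfl fun k _ => ?_
  rw [h k, withDensity_apply _ (hs k), ← lintegral_indicator (hs k),
    ← (measurePreserving_eval ν k).lintegral_comp ((hr k).indicator (hs k))]

lemma integrable_sub_sq_gaussianReal (m c : ℝ) (v : ℝ≥0) :
    Integrable (fun x => (x - c) ^ 2) (gaussianReal m v) :=
  (memLp_two_iff_integrable_sq (by fun_prop)).1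
    ((memLp_id_gaussianReal 2).sub (memLp_const c))

lemma integral_sq_gaussianReal (m : ℝ) (v : ℝ≥0) :
    ∫ x, x ^ 2 ∂gaussianReal m v = v + m ^ 2 := by
  have h := variance_eq_sub (memLp_id_gaussianReal (μ := m) (v := v) 2)
  rw [variance_id_gaussianReal] at h
  simp only [Pi.pow_apply, id, integral_id_gaussianReal] at h
  linarith

lemma integral_sub_sq_gaussianReal (m : ℝ) (v : ℝ≥0) :
    ∫ x, (x - m) ^ 2 ∂gaussianReal m v = v := by
  have h := variance_eq_integral (μ := gaussianReal m v) (X := id) (by fun_prop)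
  rw [variance_id_gaussianReal] at h
  simpa [integral_id_gaussianReal] using h.symm

/-- Lower bound for exponential moments of a centred Gaussian vector: the vector is compared with
one that is shifted by `b` and whose variances are increased by `e`, at the cost of a relative
entropy not larger than `∑ (b ^ 2 + e) / (2 v)`. -/
lemma ofReal_exp_le_lintegral_pi_gaussianReal {κ : Type*} [Fintype κ] {v : κ → ℝ≥0}
    (hv : ∀ k, v k ≠ 0) (b : κ → ℝ) (e : ℝ≥0) {G : (κ → ℝ) → ℝ} (hG : Measurable G)
    (hGi : Integrable G (Measure.pi fun k => gaussianReal (b k) (v k + e))) :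
    ENNReal.ofReal (Real.exp (-((∫ x, G x ∂Measure.pi fun k => gaussianReal (b k) (v k + e)) +
        ∑ k, (b k ^ 2 + e) / (2 * v k)))) ≤
      ∫⁻ x, ENNReal.ofReal (Real.exp (-G x)) ∂Measure.pi fun k => gaussianReal 0 (v k) := by
  have hw : ∀ k, v k + e ≠ 0 := fun k => by have := hv k; positivity
  set ν := Measure.pi fun k => gaussianReal (b k) (v k + e) with hν
  set H : κ → ℝ → ℝ := fun k x => x ^ 2 / (2 * v k) - (x - b k) ^ 2 / (2 * (v k + e : ℝ≥0)) with hH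
  have hHi1 : ∀ k, Integrable (H k) (gaussianReal (b k) (v k + e)) := fun k => by
    have h0 : Integrable (fun x : ℝ => x ^ 2) (gaussianReal (b k) (v k + e)) := by
      simpa using integrable_sub_sq_gaussianReal (b k) 0 (v k + e)
    exact (h0.div_const _).sub ((integrable_sub_sq_gaussianReal (b k) (b k) (v k + e)).div_const _)
  have hHint : ∀ k, ∫ x, H k x ∂gaussianReal (b k) (v k + e) = (b k ^ 2 + e) / (2 * v k) := by
    intro k
    have h0 : Integrable (fun x : ℝ => x ^ 2) (gaussianReal (b k) (v k + e)) := by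
      simpa using integrable_sub_sq_gaussianReal (b k) 0 (v k + e)
    rw [hH]
    simp only
    rw [integral_sub (h0.div_const _)
      ((integrable_sub_sq_gaussianReal (b k) (b k) (v k + e)).div_const _), integral_div,
      integral_div, integral_sq_gaussianReal, integral_sub_sq_gaussianReal]
    have h1 : (v k : ℝ) ≠ 0 := by exact_mod_cast hv k
    have h2 : ((v k + e : ℝ≥0) : ℝ) ≠ 0 := by exact_mod_cast hw k
    have h3 : ((v k + e : ℝ≥0) : ℝ) / (2 * ((v k + e : ℝ≥0) : ℝ)) = 1 / 2 := by field_simp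
    rw [h3]
    push_cast
    field_simp
    ring
  have hmp : ∀ k, MeasurePreserving (Function.eval k) ν (gaussianReal (b k) (v k + e)) :=
    fun k => measurePreserving_eval (fun k => gaussianReal (b k) (v k + e)) k
  have hHi : ∀ k, Integrable (fun x : κ → ℝ => H k (x k)) ν := fun k =>
    (hmp k).integrable_comp_of_integrable (hHi1 k)
  have hHint' : ∀ k, ∫ x, H k (x k) ∂ν = (b k ^ 2 + e) / (2 * v k) := by
    intro k
    rw [← hHint k, ← (hmp k).map_eq, integral_map (hmp k).aemeasurable
      (by rw [(hmp k).map_eq]; exact (hHi1 k).aestronglyMeasurable)]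
  have hKi : Integrable (fun x => G x + ∑ k, H k (x k)) ν :=
    hGi.add (integrable_finsetSum _ fun k _ => hHi k)
  have hJ := ofReal_exp_neg_integral_le hKi
  rw [integral_add hGi (integrable_finsetSum _ fun k _ => hHi k),
    integral_finsetSum _ fun k _ => hHi k] at hJ
  simp_rw [hHint'] at hJ
  refine hJ.trans ?_
  have hmr : ∀ k, Measurable fun x => gaussianPDF 0 (v k) x / gaussianPDF (b k) (v k + e) x :=
    fun k => (measurable_gaussianPDF _ _).div (measurable_gaussianPDF _ _)
  have hGm : Measurable fun x => ENNReal.ofReal (Real.exp (-G x)) := by fun_prop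
  have hprod : Measurable fun x : κ → ℝ =>
      ∏ k, gaussianPDF 0 (v k) (x k) / gaussianPDF (b k) (v k + e) (x k) :=
    Finset.measurable_fun_prod _ fun k _ => (hmr k).comp (measurable_pi_apply k)
  rw [pi_eq_pi_withDensity hmr
    fun k => gaussianReal_zero_eq_withDensity (b k) (hv k) (hw k),
    lintegral_withDensity_eq_lintegral_mul _ hprod hGm]
  refine lintegral_mono fun x => ?_
  rw [neg_add_rev, Real.exp_add, ENNReal.ofReal_mul (by positivity), ← Finset.sum_neg_distrib,
    Real.exp_sum, ENNReal.ofReal_prod_of_nonneg fun k _ => (Real.exp_pos _).le, Pi.mul_apply]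
  refine mul_le_mul_left ?_ _
  refine Finset.prod_le_prod' fun k _ => ?_
  exact exp_le_gaussianPDF_div (hv k) le_self_add (x k)

/-! ### Local time and self-intersections -/

lemma volume_box {D : ℕ} (l u : Fin D → ℝ) :
    volume {y : EuclideanSpace ℝ (Fin D) | ∀ i, y i ∈ Set.Icc (l i) (u i)} =
      ∏ i, ENNReal.ofReal (u i - l i) := by
  have h := (PiLp.volume_preserving_ofLp (Fin D)).measure_preimage
    (s := Set.univ.pi fun i => Set.Icc (l i) (u i))
    (MeasurableSet.univ_pi fun i => measurableSet_Icc).nullMeasurableSet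
  rw [volume_pi, Measure.pi_pi] at h
  simp only [Real.volume_Icc] at h
  rw [← h]
  congr 1
  ext y
  simp only [Set.mem_preimage, Set.mem_pi, Set.mem_univ, forall_const]
  rfl

lemma measurableSet_box {D : ℕ} (l u : Fin D → ℝ) :
    MeasurableSet {y : EuclideanSpace ℝ (Fin D) | ∀ i, y i ∈ Set.Icc (l i) (u i)} := by
  simp only [Set.ofPred_forall]
  exact MeasurableSet.iInter fun i => measurableSet_Icc.preimage (by fun_prop)

lemma measurableSet_unitCube {D : ℕ} (z : EuclideanSpace ℝ (Fin D)) :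
    MeasurableSet (unitCube z) := measurableSet_box _ _

lemma volume_unitCube {D : ℕ} (z : EuclideanSpace ℝ (Fin D)) : volume (unitCube z) = 1 := by
  rw [unitCube, volume_box]
  refine Finset.prod_eq_one fun i _ => ?_
  rw [show z i + 1 / 2 - (z i - 1 / 2) = 1 by ring, ENNReal.ofReal_one]

lemma mem_unitCube_comm {D : ℕ} {y z : EuclideanSpace ℝ (Fin D)} :
    y ∈ unitCube z ↔ z ∈ unitCube y := by
  simp only [unitCube, Set.mem_ofPred_eq, Set.mem_Icc]
  refine forall_congr' fun i => ?_
  constructor <;> rintro ⟨h₁, h₂⟩ <;> constructor <;> linarith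

lemma localTime_eq {d D N : ℕ} (v : Site d N → EuclideanSpace ℝ (Fin D))
    (z : EuclideanSpace ℝ (Fin D)) :
    localTime v z = ∑ x, (unitCube (v x)).indicator (fun _ => (1 : ℝ)) z := by
  refine Finset.sum_congr rfl fun x _ => ?_
  by_cases h : v x ∈ unitCube z
  · rw [Set.indicator_of_mem h, Set.indicator_of_mem (mem_unitCube_comm.1 h)]
  · rw [Set.indicator_of_notMem h, Set.indicator_of_notMem fun h' => h (mem_unitCube_comm.1 h')]

lemma localTime_sq_eq {d D N : ℕ} (v : Site d N → EuclideanSpace ℝ (Fin D))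
    (z : EuclideanSpace ℝ (Fin D)) :
    localTime v z ^ 2 =
      ∑ x, ∑ y, (unitCube (v x) ∩ unitCube (v y)).indicator (fun _ => (1 : ℝ)) z := by
  rw [localTime_eq, sq, Finset.sum_mul_sum]
  refine Finset.sum_congr rfl fun x _ => Finset.sum_congr rfl fun y _ => ?_
  by_cases h : z ∈ unitCube (v x) <;> by_cases h' : z ∈ unitCube (v y) <;>
    simp [Set.indicator, h, h']

lemma integrable_indicator_unitCube {D : ℕ} (z : EuclideanSpace ℝ (Fin D)) :
    Integrable ((unitCube z).indicator fun _ => (1 : ℝ)) :=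
  (integrable_indicator_iff (measurableSet_unitCube z)).2
    (integrableOn_const (by simp [volume_unitCube]))

lemma integrable_indicator_inter {D : ℕ} (y z : EuclideanSpace ℝ (Fin D)) :
    Integrable ((unitCube y ∩ unitCube z).indicator fun _ => (1 : ℝ)) := by
  refine (integrable_indicator_iff
    ((measurableSet_unitCube y).inter (measurableSet_unitCube z))).2 (integrableOn_const ?_)
  refine ((measure_mono Set.inter_subset_left).trans_lt ?_).ne
  simp [volume_unitCube]

lemma integrable_localTime {d D N : ℕ} (v : Site d N → EuclideanSpace ℝ (Fin D)) :
    Integrable (localTime v) := by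
  rw [show localTime v = fun z => _ from funext (localTime_eq v)]
  exact integrable_finsetSum _ fun x _ => integrable_indicator_unitCube _

lemma integrable_localTime_sq {d D N : ℕ} (v : Site d N → EuclideanSpace ℝ (Fin D)) :
    Integrable fun z => localTime v z ^ 2 := by
  simp_rw [localTime_sq_eq]
  exact integrable_finsetSum _ fun x _ => integrable_finsetSum _ fun y _ =>
    integrable_indicator_inter _ _

lemma integral_localTime {d D N : ℕ} (v : Site d N → EuclideanSpace ℝ (Fin D)) :
    ∫ z, localTime v z = (2 * N + 1) ^ d := by
  simp_rw [localTime_eq]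
  rw [integral_finsetSum _ fun x _ => integrable_indicator_unitCube _]
  simp_rw [integral_indicator (measurableSet_unitCube _)]
  rw [← card_site]
  simp [Measure.real, volume_unitCube]

/-- The squared local time integrates the number of pairs of sites whose images are close. -/
lemma integral_localTime_sq_le {d D N : ℕ} (v : Site d N → EuclideanSpace ℝ (Fin D)) :
    ∫ z, localTime v z ^ 2 ≤
      ∑ x, ∑ y, {w : Site d N → EuclideanSpace ℝ (Fin D) |
        ∀ i, w x i - w y i ∈ Set.Icc (-1 : ℝ) 1}.indicator (fun _ => (1 : ℝ)) v := by
  simp_rw [localTime_sq_eq]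
  rw [integral_finsetSum _ fun x _ => integrable_finsetSum _ fun y _ =>
    integrable_indicator_inter _ _]
  refine Finset.sum_le_sum fun x _ => ?_
  rw [integral_finsetSum _ fun y _ => integrable_indicator_inter _ _]
  refine Finset.sum_le_sum fun y _ => ?_
  rw [integral_indicator ((measurableSet_unitCube _).inter (measurableSet_unitCube _))]
  simp only [integral_const, smul_eq_mul, mul_one, measureReal_restrict_apply_univ]
  by_cases h : ∀ i, v x i - v y i ∈ Set.Icc (-1 : ℝ) 1
  · rw [Set.indicator_of_mem (by exact h)]
    refine ENNReal.toReal_le_of_le_ofReal zero_le_one ?_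
    rw [ENNReal.ofReal_one, ← volume_unitCube (v x)]
    exact measure_mono Set.inter_subset_left
  · rw [Set.indicator_of_notMem (by exact h)]
    have : unitCube (v x) ∩ unitCube (v y) = ∅ := by
      rw [Set.eq_empty_iff_forall_notMem]
      rintro z ⟨hx, hy⟩
      refine h fun i => ?_
      have h1 := hx i
      have h2 := hy i
      rw [Set.mem_Icc] at *
      constructor <;> linarith [h1.1, h1.2, h2.1, h2.2]
    simp [this]

lemma norm_sub_le_effectiveRadius {d D N : ℕ} (v : Site d N → EuclideanSpace ℝ (Fin D))
    (x y : Site d N) : ‖v x - v y‖ ≤ effectiveRadius v :=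
  le_ciSup (f := fun p : Site d N × Site d N => ‖v p.1 - v p.2‖) (Set.finite_range _).bddAbove (x, y)

lemma effectiveRadius_nonneg {d D N : ℕ} (v : Site d N → EuclideanSpace ℝ (Fin D)) :
    0 ≤ effectiveRadius v := Real.iSup_nonneg fun _ => norm_nonneg _

/-- By the Cauchy-Schwarz inequality a configuration of small radius has many
self-intersections. -/
lemma div_le_integral_localTime_sq {d D N : ℕ} (v : Site d N → EuclideanSpace ℝ (Fin D)) :
    ((2 * N + 1 : ℝ) ^ d) ^ 2 / (2 * effectiveRadius v + 1) ^ D ≤ ∫ z, localTime v z ^ 2 := by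
  set R := effectiveRadius v with hR
  have hR0 : 0 ≤ R := effectiveRadius_nonneg v
  set n : ℝ := (2 * N + 1) ^ d with hn
  set V : ℝ := (2 * R + 1) ^ D with hV
  have hV0 : 0 < V := by positivity
  let o : Site d N := fun _ => ⟨0, by simp⟩
  set B : Set (EuclideanSpace ℝ (Fin D)) :=
    {y | ∀ i, y i ∈ Set.Icc (v o i - (R + 1 / 2)) (v o i + (R + 1 / 2))} with hB
  have hBm : MeasurableSet B := measurableSet_box _ _
  have hBv : volume B = ENNReal.ofReal V := by
    rw [hB, volume_box]
    have : ∀ i, v o i + (R + 1 / 2) - (v o i - (R + 1 / 2)) = 2 * R + 1 := fun i => by ring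
    simp only [this, Finset.prod_const, Finset.card_univ, Fintype.card_fin]
    rw [hV, ENNReal.ofReal_pow (by positivity)]
  have hsupp : ∀ z, z ∉ B → localTime v z = 0 := by
    intro z hz
    rw [localTime_eq]
    refine Finset.sum_eq_zero fun x _ => Set.indicator_of_notMem (fun hx => hz fun i => ?_) _
    have h1 := hx i
    have h2 : |v x i - v o i| ≤ R :=
      (PiLp.norm_apply_le (v x - v o) i).trans (norm_sub_le_effectiveRadius v x o)
    rw [abs_le] at h2
    rw [Set.mem_Icc] at *
    constructor <;> linarith [h1.1, h1.2, h2.1, h2.2]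
  have hBi : Integrable (B.indicator fun _ => (1 : ℝ)) :=
    (integrable_indicator_iff hBm).2 (integrableOn_const (by simp [hBv]))
  have hBint : ∫ z, B.indicator (fun _ => (1 : ℝ)) z = V := by
    rw [integral_indicator hBm]
    simp [Measure.real, hBv, hV0.le]
  have hpt : ∀ z, 2 * (n / V) * localTime v z - (n / V) ^ 2 * B.indicator (fun _ => (1 : ℝ)) z ≤
      localTime v z ^ 2 := by
    intro z
    by_cases hz : z ∈ B
    · rw [Set.indicator_of_mem hz]
      nlinarith [sq_nonneg (localTime v z - n / V)]
    · rw [Set.indicator_of_notMem hz, hsupp z hz]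
      simp
  have hint : ∫ z, (2 * (n / V) * localTime v z - (n / V) ^ 2 * B.indicator (fun _ => (1 : ℝ)) z) ≤
      ∫ z, localTime v z ^ 2 := integral_mono (((integrable_localTime v).const_mul (2 * (n / V))).sub
    (hBi.const_mul ((n / V) ^ 2))) (integrable_localTime_sq v) hpt
  rw [integral_sub ((integrable_localTime v).const_mul _) (hBi.const_mul _), integral_const_mul,
    integral_const_mul, integral_localTime, hBint, ← hn] at hint
  refine le_trans (le_of_eq ?_) hint
  field_simp
  ring

lemma field_apply {d D N : ℕ} (X : Fin D × Mode d N → ℝ) (x : Site d N) (i : Fin D) :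
    field d D N X x i = ∑ k : Mode d N, X (i, k) * eigenfun d N k x := rfl

lemma field_sub_apply {d D N : ℕ} (X : Fin D × Mode d N → ℝ) (x y : Site d N) (i : Fin D) :
    field d D N X x i - field d D N X y i = ∑ k : Mode d N, X (i, k) * incr x y k := by
  rw [field_apply, field_apply, ← Finset.sum_sub_distrib]
  exact Finset.sum_congr rfl fun k _ => by rw [incr]; ring

/-- The self-intersection energy `∫ ℓ(y)² dy` of the free field. -/
def selfIntersection (d D N : ℕ) (X : Fin D × Mode d N → ℝ) : ℝ :=
  ∫ z, localTime (field d D N X) z ^ 2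

lemma measurable_selfIntersection (d D N : ℕ) : Measurable (selfIntersection d D N) := by
  have h : Measurable fun p : (Fin D × Mode d N → ℝ) × EuclideanSpace ℝ (Fin D) =>
      localTime (field d D N p.1) p.2 ^ 2 := by
    have h1 : ∀ x : Site d N, MeasurableSet
        {p : (Fin D × Mode d N → ℝ) × EuclideanSpace ℝ (Fin D) |
          field d D N p.1 x ∈ unitCube p.2} := by
      intro x
      have : {p : (Fin D × Mode d N → ℝ) × EuclideanSpace ℝ (Fin D) |
          field d D N p.1 x ∈ unitCube p.2} = ⋂ i : Fin D,
          {p | p.2 i - 1 / 2 ≤ ∑ k : Mode d N, p.1 (i, k) * eigenfun d N k x} ∩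
          {p | ∑ k : Mode d N, p.1 (i, k) * eigenfun d N k x ≤ p.2 i + 1 / 2} := by
        ext p
        simp [unitCube, field_apply]
      rw [this]
      refine MeasurableSet.iInter fun i => MeasurableSet.inter ?_ ?_
      · exact measurableSet_le (by fun_prop) (by fun_prop)
      · exact measurableSet_le (by fun_prop) (by fun_prop)
    have h2 : (fun p : (Fin D × Mode d N → ℝ) × EuclideanSpace ℝ (Fin D) =>
        localTime (field d D N p.1) p.2) = fun p => ∑ x,
          {p : (Fin D × Mode d N → ℝ) × EuclideanSpace ℝ (Fin D) |
            field d D N p.1 x ∈ unitCube p.2}.indicator (fun _ => (1 : ℝ)) p := by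
      funext p
      rfl
    have h3 : Measurable fun p : (Fin D × Mode d N → ℝ) × EuclideanSpace ℝ (Fin D) =>
        localTime (field d D N p.1) p.2 := by
      rw [h2]
      exact Finset.measurable_fun_sum _ fun x _ => measurable_const.indicator (h1 x)
    exact h3.pow_const 2
  exact (StronglyMeasurable.integral_prod_right' (ν := volume) h.stronglyMeasurable).measurable

lemma selfIntersection_nonneg (d D N : ℕ) (X : Fin D × Mode d N → ℝ) :
    0 ≤ selfIntersection d D N X := integral_nonneg fun _ => sq_nonneg _

lemma measurableSet_close (d D N : ℕ) (x y : Site d N) :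
    MeasurableSet {X : Fin D × Mode d N → ℝ |
      ∀ i, ∑ k : Mode d N, X (i, k) * incr x y k ∈ Set.Icc (-1 : ℝ) 1} := by
  rw [Set.ofPred_forall]
  exact MeasurableSet.iInter fun i => measurableSet_Icc.preimage (by fun_prop)

lemma selfIntersection_le (d D N : ℕ) (X : Fin D × Mode d N → ℝ) :
    selfIntersection d D N X ≤ ∑ x : Site d N, ∑ y : Site d N,
      {X : Fin D × Mode d N → ℝ |
        ∀ i, ∑ k : Mode d N, X (i, k) * incr x y k ∈ Set.Icc (-1 : ℝ) 1}.indicator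
          (fun _ => (1 : ℝ)) X := by
  refine (integral_localTime_sq_le _).trans (le_of_eq ?_)
  refine Finset.sum_congr rfl fun x _ => Finset.sum_congr rfl fun y _ => ?_
  simp only [Set.indicator, Set.mem_ofPred_eq, field_sub_apply]

lemma integrable_selfIntersection (d D N : ℕ) (ν : Measure (Fin D × Mode d N → ℝ))
    [IsFiniteMeasure ν] : Integrable (selfIntersection d D N) ν := by
  refine Integrable.of_bound (measurable_selfIntersection d D N).aestronglyMeasurable
    (∑ _x : Site d N, ∑ _y : Site d N, 1) (Eventually.of_forall fun X => ?_)
  rw [Real.norm_of_nonneg (selfIntersection_nonneg d D N X)]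
  refine (selfIntersection_le d D N X).trans ?_
  exact Finset.sum_le_sum fun x _ => Finset.sum_le_sum fun y _ =>
    Set.indicator_apply_le' (fun _ => le_rfl) fun _ => zero_le_one

lemma integral_selfIntersection_le (d D N : ℕ) (ν : Measure (Fin D × Mode d N → ℝ))
    [IsFiniteMeasure ν] :
    ∫ X, selfIntersection d D N X ∂ν ≤ ∑ x : Site d N, ∑ y : Site d N,
      ν.real {X | ∀ i, ∑ k : Mode d N, X (i, k) * incr x y k ∈ Set.Icc (-1 : ℝ) 1} := by
  have hi : ∀ x y : Site d N, Integrable ({X : Fin D × Mode d N → ℝ |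
        ∀ i, ∑ k : Mode d N, X (i, k) * incr x y k ∈ Set.Icc (-1 : ℝ) 1}.indicator
          (fun _ => (1 : ℝ))) ν := fun x y =>
    (integrable_const _).indicator (measurableSet_close d D N x y)
  refine (integral_mono (integrable_selfIntersection d D N ν)
    (integrable_finsetSum _ fun x _ => integrable_finsetSum _ fun y _ => hi x y)
    (selfIntersection_le d D N)).trans (le_of_eq ?_)
  rw [integral_finsetSum _ fun x _ => integrable_finsetSum _ fun y _ => hi x y]
  refine Finset.sum_congr rfl fun x _ => ?_
  rw [integral_finsetSum _ fun y _ => hi x y]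
  refine Finset.sum_congr rfl fun y _ => ?_
  rw [integral_indicator (measurableSet_close d D N x y)]
  simp

/-! ### Lower bound for the partition function -/

lemma weight_field {d D N : ℕ} (γ : ℝ) (X : Fin D × Mode d N → ℝ) :
    weight γ (field d D N X) = Real.exp (-(γ * selfIntersection d D N X)) := by
  rw [weight, selfIntersection, neg_mul]

/-- The variance of a mode of the free field. -/
def modeVar {d N : ℕ} (β : ℝ) (k : Mode d N) : ℝ≥0 := ((2 * β * lam d N k)⁻¹).toNNReal

lemma coe_modeVar {d N : ℕ} {β : ℝ} (hβ : 0 < β) (k : Mode d N) :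
    (modeVar β k : ℝ) = (2 * β * lam d N k)⁻¹ := by
  have := lam_pos k
  exact Real.coe_toNNReal _ (by positivity)

lemma modeVar_ne_zero {d N : ℕ} {β : ℝ} (hβ : 0 < β) (k : Mode d N) : modeVar β k ≠ 0 := by
  have := lam_pos k
  rw [← NNReal.coe_ne_zero, coe_modeVar hβ]
  positivity

lemma gaussianLaw_eq (d D N : ℕ) (β : ℝ) : gaussianLaw d D N β =
    Measure.pi fun p : Fin D × Mode d N => gaussianReal 0 (modeVar β p.2) := rfl

instance (d D N : ℕ) (β : ℝ) : IsProbabilityMeasure (gaussianLaw d D N β) := by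
  rw [gaussianLaw_eq]; infer_instance

/-- The shift of the modes: `u^{(i)}` is shifted by the function `a x_i`. -/
def linearShift {d D N : ℕ} (hD : D ≤ d) (a : ℝ) (p : Fin D × Mode d N) : ℝ :=
  coeff (fun x : Site d N => a * ((x (Fin.castLE hD p.1) : ℤ) : ℝ)) p.2

/-- The law of a field that is stretched linearly with slope `a` and carries an additional noise of
standard deviation `a`, independent at the different sites. The noise spreads the sites
with equal first `D` coordinates over the gaps left by the linear map. -/
def stretchedLaw {d D N : ℕ} (hD : D ≤ d) (β a : ℝ) : Measure (Fin D × Mode d N → ℝ) :=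
  Measure.pi fun p => gaussianReal (linearShift hD a p) (modeVar β p.2 + (a ^ 2).toNNReal)

instance {d D N : ℕ} (hD : D ≤ d) (β a : ℝ) :
    IsProbabilityMeasure (stretchedLaw hD β a : Measure (Fin D × Mode d N → ℝ)) := by
  rw [stretchedLaw]; infer_instance

lemma sum_var_mul_incr_sq {d N : ℕ} (hd : 2 ≤ d) {β : ℝ} (hβ : 0 < β) (e : ℝ≥0)
    {x y : Site d N} (hxy : x ≠ y) :
    ((∑ k : Mode d N, (modeVar β k + e) * (incr x y k ^ 2).toNNReal : ℝ≥0) : ℝ) =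
      resistance x y / (2 * β) + 2 * e := by
  have h2 : (2 : ℝ) * e = (∑ k : Mode d N, incr x y k ^ 2) * e := by rw [sum_incr_sq hd hxy]
  rw [NNReal.coe_sum, h2, resistance, Finset.sum_div, Finset.sum_mul, ← Finset.sum_add_distrib]
  refine Finset.sum_congr rfl fun k _ => ?_
  have := lam_pos k
  rw [NNReal.coe_mul, NNReal.coe_add, coe_modeVar hβ, Real.coe_toNNReal _ (sq_nonneg _)]
  field_simp

lemma stretchedLaw_close_le {d D N : ℕ} (hd : 2 ≤ d) (hD : D ≤ d) {β a w₀ M : ℝ} (hβ : 0 < β)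
    (ha : 1 ≤ a) (hw₀ : 0 < w₀) (hM : 0 < M) {x y : Site d N} (hxy : x ≠ y)
    (h₁ : w₀ ≤ resistance x y / (2 * β) + 2 * a ^ 2)
    (h₂ : resistance x y / (2 * β) + 2 * a ^ 2 ≤ M * w₀) :
    (stretchedLaw hD β a).real
        {X | ∀ i : Fin D, ∑ k : Mode d N, X (i, k) * incr x y k ∈ Set.Icc (-1 : ℝ) 1} ≤
      ∏ i : Fin D, hitBound a w₀ M ((x (Fin.castLE hD i) : ℤ) - y (Fin.castLE hD i)) := by
  refine ENNReal.toReal_le_of_le_ofReal (Finset.prod_nonneg fun i _ => hitBound_nonneg _ _ _ _) ?_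
  rw [stretchedLaw, pi_gaussianReal_forall_mem _ _ _ measurableSet_Icc,
    ENNReal.ofReal_prod_of_nonneg fun i _ => hitBound_nonneg _ _ _ _]
  refine Finset.prod_le_prod' fun i _ => ?_
  have hmean : ∑ k : Mode d N, linearShift hD a (i, k) * incr x y k =
      a * (((x (Fin.castLE hD i) : ℤ) - y (Fin.castLE hD i) : ℤ) : ℝ) := by
    have := sum_coeff_mul_incr hd (fun x : Site d N => a * ((x (Fin.castLE hD i) : ℤ) : ℝ)) x y
    simp only [linearShift]
    rw [this]
    push_cast
    ring
  have hvar := sum_var_mul_incr_sq hd hβ (a ^ 2).toNNReal hxy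
  rw [Real.coe_toNNReal _ (sq_nonneg a)] at hvar
  rw [hmean]
  exact gaussianReal_Icc_le ha hw₀ hM (by rw [hvar]; exact h₁) (by rw [hvar]; exact h₂) _

/-- The coordinates with index at least `D` are summed out freely. -/
lemma sum_prod_castLE {S : Type*} [Fintype S] {d D : ℕ} (hD : D ≤ d) (g : Fin D → S → ℝ) :
    ∑ y : Fin d → S, ∏ i, g i (y (Fin.castLE hD i)) =
      (∏ i, ∑ s, g i s) * (Fintype.card S : ℝ) ^ (d - D) := by
  obtain ⟨e, rfl⟩ := Nat.exists_eq_add_of_le hD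
  have h := Finset.prod_univ_sum (fun _ : Fin (D + e) => (Finset.univ : Finset S))
    (fun j s => Fin.addCases (motive := fun _ => S → ℝ) g (fun _ _ => 1) j s)
  rw [Fintype.piFinset_univ, Fin.prod_univ_add] at h
  simp only [Fin.addCases_left, Fin.addCases_right, Fin.prod_univ_add, Finset.prod_const_one,
    mul_one, Finset.sum_const, Finset.card_univ, Finset.prod_const, Fintype.card_fin,
    nsmul_eq_mul] at h
  rw [Nat.add_sub_cancel_left, h]
  rfl

/-- The expected self-intersection energy of the stretched field. -/
lemma integral_selfIntersection_stretchedLaw_le {d D N : ℕ} (hd : 2 ≤ d) (hD : D ≤ d)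
    {β a w₀ M : ℝ} (hβ : 0 < β) (ha : 1 ≤ a) (hw₀ : a ^ 2 ≤ w₀) (hM : 1 ≤ M)
    (h : ∀ x y : Site d N, x ≠ y → w₀ ≤ resistance x y / (2 * β) + 2 * a ^ 2 ∧
      resistance x y / (2 * β) + 2 * a ^ 2 ≤ M * w₀) :
    ∫ X, selfIntersection d D N X ∂(stretchedLaw hD β a) ≤
      (2 * N + 1) ^ d * (1 + ((24 + 16 * M) / a) ^ D * (2 * N + 1) ^ (d - D)) := by
  have ha0 : 0 < a := by linarith
  have hw : 0 < w₀ := lt_of_lt_of_le (by positivity) hw₀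
  set P : Site d N → Site d N → ℝ := fun x y =>
    ∏ i : Fin D, hitBound a w₀ M ((x (Fin.castLE hD i) : ℤ) - y (Fin.castLE hD i)) with hP
  have hP0 : ∀ x y, 0 ≤ P x y := fun x y => Finset.prod_nonneg fun i _ => hitBound_nonneg _ _ _ _
  have hrow : ∀ x, ∑ y, P x y ≤ ((24 + 16 * M) / a) ^ D * (2 * N + 1) ^ (d - D) := by
    intro x
    have h1 := sum_prod_castLE hD (S := ↥(Finset.Icc (-(N : ℤ)) (N : ℤ)))
      fun i t => hitBound a w₀ M ((x (Fin.castLE hD i) : ℤ) - t)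
    have h2 : (Fintype.card ↥(Finset.Icc (-(N : ℤ)) (N : ℤ)) : ℝ) = 2 * N + 1 := by
      have : (Int.toNat ((N : ℤ) + 1 + (N : ℤ))) = 2 * N + 1 := by omega
      simp [this]
    rw [h2] at h1
    rw [hP]
    refine h1.le.trans (mul_le_mul_of_nonneg_right ?_ (by positivity))
    calc _ ≤ ∏ _i : Fin D, (24 + 16 * M) / a := by
          refine Finset.prod_le_prod (fun i _ => Finset.sum_nonneg fun t _ =>
            hitBound_nonneg _ _ _ _) fun i _ => ?_
          rw [Finset.sum_coe_sort (Finset.Icc (-(N : ℤ)) (N : ℤ))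
            (fun t => hitBound a w₀ M ((x (Fin.castLE hD i) : ℤ) - t))]
          exact sum_hitBound_le ha hw₀ hM (x _).2
      _ = _ := by rw [Finset.prod_const, Finset.card_univ, Fintype.card_fin]
  refine (integral_selfIntersection_le d D N _).trans ?_
  calc _ ≤ ∑ x : Site d N, ∑ y : Site d N, ((if x = y then 1 else 0) + P x y) := by
        refine Finset.sum_le_sum fun x _ => Finset.sum_le_sum fun y _ => ?_
        split_ifs with hxy
        · have := hP0 x y
          have : (stretchedLaw hD β a).real {X | ∀ i : Fin D, ∑ k : Mode d N,
            X (i, k) * incr x y k ∈ Set.Icc (-1 : ℝ) 1} ≤ 1 := measureReal_le_one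
          linarith
        · rw [zero_add]
          exact stretchedLaw_close_le hd hD hβ ha hw (by linarith) hxy (h x y hxy).1 (h x y hxy).2
    _ ≤ ∑ x : Site d N, (1 + ((24 + 16 * M) / a) ^ D * (2 * N + 1) ^ (d - D)) := by
        refine Finset.sum_le_sum fun x _ => ?_
        rw [Finset.sum_add_distrib]
        simp only [Finset.sum_ite_eq, Finset.mem_univ, if_true]
        linarith [hrow x]
    _ = _ := by rw [Finset.sum_const, Finset.card_univ, nsmul_eq_mul, card_site]

/-- The cost of stretching the field. -/
lemma sum_entropy_le {d D N : ℕ} (hD : D ≤ d) {β : ℝ} (hβ : 0 < β) (a : ℝ) :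
    ∑ p : Fin D × Mode d N, (linearShift hD a p ^ 2 + ((a ^ 2).toNNReal : ℝ)) /
      (2 * modeVar β p.2) ≤ β * (D * 3 ^ (d + 1) * a ^ 2 * (2 * N + 1) ^ d) := by
  rw [Fintype.sum_prod_type]
  calc _ ≤ ∑ _i : Fin D, β * (3 ^ (d + 1) * a ^ 2 * (2 * N + 1) ^ d) := by
        refine Finset.sum_le_sum fun i _ => ?_
        have h1 : ∀ k : Mode d N, (linearShift hD a (i, k) ^ 2 + ((a ^ 2).toNNReal : ℝ)) /
            (2 * modeVar β k) = β * (lam d N k *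
              coeff (fun x : Site d N => a * ((x (Fin.castLE hD i) : ℤ) : ℝ)) k ^ 2
              + a ^ 2 * lam d N k) := by
          intro k
          have := lam_pos k
          rw [coe_modeVar hβ, Real.coe_toNNReal _ (sq_nonneg a), linearShift]
          field_simp
        simp only [h1]
        rw [← Finset.mul_sum, Finset.sum_add_distrib, sum_lam_mul_coeff_sq, ← Finset.mul_sum]
        refine mul_le_mul_of_nonneg_left ?_ hβ.le
        have h2 := edgeEnergy_coordinate_le (N := N) a (Fin.castLE hD i)
        have h3 := mul_le_mul_of_nonneg_left (sum_lam_le d N) (sq_nonneg a)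
        have h4 : (0 : ℝ) ≤ a ^ 2 * 3 ^ d * (2 * N + 1) ^ d := by positivity
        rw [pow_succ 3 d]
        linarith
    _ = _ := by
        rw [Finset.sum_const, Finset.card_univ, Fintype.card_fin, nsmul_eq_mul]
        ring

lemma weight_nonneg {d D N : ℕ} (γ : ℝ) (v : Site d N → EuclideanSpace ℝ (Fin D)) :
    0 ≤ weight γ v := Real.exp_nonneg _

lemma measurable_weight_field (d D N : ℕ) (γ : ℝ) :
    Measurable fun X => weight γ (field d D N X) := by
  simp_rw [weight_field]
  have := measurable_selfIntersection d D N
  fun_prop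

lemma weight_field_le_one {d D N : ℕ} {γ : ℝ} (hγ : 0 < γ) (X : Fin D × Mode d N → ℝ) :
    weight γ (field d D N X) ≤ 1 := by
  rw [weight_field]
  refine Real.exp_le_one_iff.2 ?_
  have := selfIntersection_nonneg d D N X
  have : 0 ≤ γ * selfIntersection d D N X := by positivity
  linarith

lemma integrable_weight_field (d D N : ℕ) (β : ℝ) {γ : ℝ} (hγ : 0 < γ) :
    Integrable (fun X => weight γ (field d D N X)) (gaussianLaw d D N β) :=
  Integrable.of_bound (measurable_weight_field d D N γ).aestronglyMeasurable 1
    (Eventually.of_forall fun X => by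
      rw [Real.norm_of_nonneg (weight_nonneg γ _)]
      exact weight_field_le_one hγ X)

lemma ofReal_partitionFunction (d D N : ℕ) (β : ℝ) {γ : ℝ} (hγ : 0 < γ) :
    ENNReal.ofReal (partitionFunction d D N β γ) =
      ∫⁻ X, ENNReal.ofReal (weight γ (field d D N X)) ∂gaussianLaw d D N β :=
  ofReal_integral_eq_lintegral_ofReal (integrable_weight_field d D N β hγ)
    (Eventually.of_forall fun _ => weight_nonneg γ _)

lemma exp_le_partitionFunction {d D N : ℕ} (hd : 2 ≤ d) (hD : D ≤ d)
    {β γ a w₀ M : ℝ} (hβ : 0 < β) (hγ : 0 < γ) (ha : 1 ≤ a) (hw₀ : a ^ 2 ≤ w₀) (hM : 1 ≤ M)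
    (h : ∀ x y : Site d N, x ≠ y → w₀ ≤ resistance x y / (2 * β) + 2 * a ^ 2 ∧
      resistance x y / (2 * β) + 2 * a ^ 2 ≤ M * w₀) :
    Real.exp (-(γ * ((2 * N + 1) ^ d *
        (1 + ((24 + 16 * M) / a) ^ D * (2 * N + 1) ^ (d - D))) +
      β * (D * 3 ^ (d + 1) * a ^ 2 * (2 * N + 1) ^ d))) ≤ partitionFunction d D N β γ := by
  have hZ0 : 0 ≤ partitionFunction d D N β γ := integral_nonneg fun _ => weight_nonneg γ _
  rw [← ENNReal.ofReal_le_ofReal_iff hZ0, ofReal_partitionFunction d D N β hγ]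
  have h1 := ofReal_exp_le_lintegral_pi_gaussianReal
    (v := fun p : Fin D × Mode d N => modeVar β p.2) (fun p => modeVar_ne_zero hβ p.2)
    (linearShift hD a) (a ^ 2).toNNReal ((measurable_selfIntersection d D N).const_mul γ)
    ((integrable_selfIntersection d D N (stretchedLaw hD β a)).const_mul γ)
  simp_rw [weight_field]
  refine le_trans (ENNReal.ofReal_le_ofReal (Real.exp_le_exp.2 (neg_le_neg ?_))) h1
  refine add_le_add ?_ (sum_entropy_le hD hβ a)
  rw [integral_const_mul]
  exact mul_le_mul_of_nonneg_left
    (integral_selfIntersection_stretchedLaw_le hd hD hβ ha hw₀ hM h) hγ.le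

/-- The choice of the slope `a = N ^ ((d - D) / (D + 2))` balances the cost of stretching and the
self-intersection energy. -/
lemma exp_rpow_le_partitionFunction {d D N : ℕ} (hd : 2 ≤ d) (hD : D ≤ d) (hN : 1 ≤ N)
    {β γ a w₀ M : ℝ} (hβ : 0 < β) (hγ : 0 < γ)
    (ha : a = (N : ℝ) ^ (((d : ℝ) - D) / (D + 2))) (hw₀ : a ^ 2 ≤ w₀) (hM : 1 ≤ M)
    (h : ∀ x y : Site d N, x ≠ y → w₀ ≤ resistance x y / (2 * β) + 2 * a ^ 2 ∧
      resistance x y / (2 * β) + 2 * a ^ 2 ≤ M * w₀) :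
    Real.exp (-((3 ^ d + 9 ^ d * (24 + 16 * M) ^ D + D * 3 ^ (2 * d + 1)) * (β + γ) *
      (N : ℝ) ^ ((d : ℝ) + 2 * (d - D) / (D + 2)))) ≤ partitionFunction d D N β γ := by
  have hN1 : (1 : ℝ) ≤ N := by exact_mod_cast hN
  have hN0 : (0 : ℝ) < N := by linarith
  have hDd : (0 : ℝ) ≤ (d : ℝ) - D := by
    have : (D : ℝ) ≤ d := by exact_mod_cast hD
    linarith
  set s := ((d : ℝ) - D) / (D + 2) with hs
  have hs0 : 0 ≤ s := by positivity
  have ha1 : 1 ≤ a := by rw [ha]; exact Real.one_le_rpow hN1 hs0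
  refine le_trans (Real.exp_le_exp.2 (neg_le_neg ?_))
    (exp_le_partitionFunction hd hD hβ hγ ha1 hw₀ hM h)
  set T := (N : ℝ) ^ ((d : ℝ) + 2 * (d - D) / (D + 2)) with hT
  have hT0 : 0 < T := by positivity
  have haT : a ^ 2 * (N : ℝ) ^ d = T := by
    rw [ha, ← Real.rpow_natCast, ← Real.rpow_mul hN0.le, ← Real.rpow_natCast, ← Real.rpow_add hN0]
    congr 1
    rw [hs]
    push_cast
    ring
  have hNT : (N : ℝ) ^ d ≤ T := by
    rw [← haT]
    exact le_mul_of_one_le_left (by positivity) (one_le_pow₀ ha1)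
  have hvol : (N : ℝ) ^ d * (N : ℝ) ^ (d - D) / a ^ D = T := by
    have h1 : (N : ℝ) ^ (d - D) = a ^ (D + 2) := by
      rw [ha, ← Real.rpow_natCast, ← Real.rpow_natCast, ← Real.rpow_mul hN0.le,
        Nat.cast_sub hD, hs]
      congr 1
      push_cast
      field_simp
    rw [h1, ← haT, pow_add]
    field_simp
  have h3N : (2 * N + 1 : ℝ) ≤ 3 * N := by linarith
  have hn : (2 * N + 1 : ℝ) ^ d ≤ 3 ^ d * (N : ℝ) ^ d := by
    rw [← mul_pow]; gcongr
  have hn' : (2 * N + 1 : ℝ) ^ (d - D) ≤ 3 ^ d * (N : ℝ) ^ (d - D) := by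
    calc (2 * N + 1 : ℝ) ^ (d - D) ≤ (3 * N) ^ (d - D) := by gcongr
      _ = 3 ^ (d - D) * (N : ℝ) ^ (d - D) := mul_pow _ _ _
      _ ≤ _ := by
        gcongr
        · norm_num
        · omega
  have e1 : (2 * N + 1 : ℝ) ^ d * (1 + ((24 + 16 * M) / a) ^ D * (2 * N + 1) ^ (d - D)) ≤
      (3 ^ d + 9 ^ d * (24 + 16 * M) ^ D) * T := by
    calc _ ≤ 3 ^ d * (N : ℝ) ^ d *
          (1 + ((24 + 16 * M) / a) ^ D * (3 ^ d * (N : ℝ) ^ (d - D))) := by gcongr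
      _ = 3 ^ d * (N : ℝ) ^ d + (3 ^ d * 3 ^ d) * (24 + 16 * M) ^ D *
          ((N : ℝ) ^ d * (N : ℝ) ^ (d - D) / a ^ D) := by rw [div_pow]; ring
      _ = 3 ^ d * (N : ℝ) ^ d + 9 ^ d * (24 + 16 * M) ^ D * T := by
          have : (3 : ℝ) ^ d * 3 ^ d = 9 ^ d := by rw [← mul_pow]; norm_num
          rw [hvol, this]
      _ ≤ 3 ^ d * T + 9 ^ d * (24 + 16 * M) ^ D * T := by gcongr
      _ = _ := by ring
  have e2 : (D : ℝ) * 3 ^ (d + 1) * a ^ 2 * (2 * N + 1) ^ d ≤ D * 3 ^ (2 * d + 1) * T := by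
    calc _ ≤ (D : ℝ) * 3 ^ (d + 1) * a ^ 2 * (3 ^ d * (N : ℝ) ^ d) := by gcongr
      _ = D * 3 ^ (2 * d + 1) * (a ^ 2 * (N : ℝ) ^ d) := by ring
      _ = _ := by rw [haT]
  have hA : 0 ≤ (3 ^ d + 9 ^ d * (24 + 16 * M) ^ D) * T := by positivity
  have hB : 0 ≤ (D : ℝ) * 3 ^ (2 * d + 1) * T := by positivity
  nlinarith [mul_le_mul_of_nonneg_left e1 hγ.le, mul_le_mul_of_nonneg_left e2 hβ.le,
    mul_nonneg hβ.le hA, mul_nonneg hγ.le hB]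

/-! ### Concentration of the effective radius -/

lemma selfAvoidingLaw_univ {d D N : ℕ} (β : ℝ) {γ : ℝ} (hγ : 0 < γ)
    (hZ : 0 < partitionFunction d D N β γ) : selfAvoidingLaw d D N β γ Set.univ = 1 := by
  rw [selfAvoidingLaw, withDensity_apply _ MeasurableSet.univ, Measure.restrict_univ]
  simp_rw [div_eq_mul_inv]
  have h : ∀ X : Fin D × Mode d N → ℝ,
      ENNReal.ofReal (weight γ (field d D N X) * (partitionFunction d D N β γ)⁻¹) =
      ENNReal.ofReal (weight γ (field d D N X)) *
        ENNReal.ofReal (partitionFunction d D N β γ)⁻¹ := fun X =>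
    ENNReal.ofReal_mul (weight_nonneg γ _)
  simp_rw [h]
  rw [lintegral_mul_const _ (measurable_weight_field d D N γ).ennreal_ofReal,
    ← ofReal_partitionFunction d D N β hγ, ← ENNReal.ofReal_mul hZ.le, mul_inv_cancel₀ hZ.ne',
    ENNReal.ofReal_one]

lemma selfAvoidingLaw_le {d D N : ℕ} {β γ : ℝ} (hZ : 0 < partitionFunction d D N β γ)
    {A : Set (Fin D × Mode d N → ℝ)} {c : ℝ} (hA : ∀ X ∈ A, weight γ (field d D N X) ≤ c) :
    selfAvoidingLaw d D N β γ A ≤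
      ENNReal.ofReal (c / partitionFunction d D N β γ) * gaussianLaw d D N β A := by
  rw [selfAvoidingLaw, withDensity_apply']
  calc _ ≤ ∫⁻ _ in A, ENNReal.ofReal (c / partitionFunction d D N β γ) ∂gaussianLaw d D N β :=
        setLIntegral_mono measurable_const fun X hX =>
          ENNReal.ofReal_le_ofReal (div_le_div_of_nonneg_right (hA X hX) hZ.le)
    _ = _ := setLIntegral_const _ _

/-- Tail bound for the effective radius of the free field, from a union bound over all pairs of
sites and all components. -/
lemma gaussianLaw_lt_effectiveRadius_le {d D N : ℕ} (hD : 1 ≤ D) {β r S : ℝ} (hβ : 0 < β)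
    (hr : 0 ≤ r) (hS : 0 < S) (hres : ∀ x y : Site d N, resistance x y ≤ 2 * S) :
    gaussianLaw d D N β {X | r < effectiveRadius (field d D N X)} ≤
      ENNReal.ofReal (((2 * N + 1) ^ d) ^ 2 * D *
        (2 * Real.exp (-(β * r ^ 2 / (2 * D ^ 2 * S))))) := by
  have : Nonempty (Site d N) := ⟨fun _ => ⟨0, by simp⟩⟩
  have hD' : (0 : ℝ) < D := by exact_mod_cast hD
  set B : Site d N → Site d N → Fin D → Set (Fin D × Mode d N → ℝ) := fun x y i =>
    {X | r / D ≤ |∑ k : Mode d N, X (i, k) * incr x y k|} with hB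
  have hsub : {X | r < effectiveRadius (field d D N X)} ⊆
      ⋃ x ∈ (Finset.univ : Finset (Site d N)), ⋃ y ∈ (Finset.univ : Finset (Site d N)),
        ⋃ i ∈ (Finset.univ : Finset (Fin D)), B x y i := by
    intro X hX
    obtain ⟨p, hp⟩ := exists_lt_of_lt_ciSup (show r < effectiveRadius (field d D N X) from hX)
    simp only [Finset.mem_univ, Set.iUnion_true, Set.mem_iUnion]
    by_contra hcon
    push Not at hcon
    have h1 : ∀ i, |(field d D N X p.1 - field d D N X p.2) i| ≤ r / D := by
      intro i
      have := hcon p.1 p.2 i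
      rw [PiLp.sub_apply, field_sub_apply]
      exact (not_le.1 this).le
    have h2 : ‖field d D N X p.1 - field d D N X p.2‖ ≤ r := by
      rw [EuclideanSpace.norm_eq]
      refine Real.sqrt_le_iff.2 ⟨hr, ?_⟩
      calc _ ≤ ∑ _i : Fin D, (r / D) ^ 2 := by
            refine Finset.sum_le_sum fun i _ => ?_
            rw [Real.norm_eq_abs]
            exact pow_le_pow_left₀ (abs_nonneg _) (h1 i) 2
        _ = r ^ 2 / D := by
            rw [Finset.sum_const, Finset.card_univ, Fintype.card_fin, nsmul_eq_mul]
            field_simp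
        _ ≤ r ^ 2 := div_le_self (sq_nonneg _) (by exact_mod_cast hD)
    exact absurd hp (not_lt.2 h2)
  have hone : ∀ x y i, gaussianLaw d D N β (B x y i) ≤
      ENNReal.ofReal (2 * Real.exp (-(β * r ^ 2 / (2 * D ^ 2 * S)))) := by
    intro x y i
    set c : Fin D × Mode d N → ℝ := fun p => if p.1 = i then incr x y p.2 else 0 with hc
    have hmap := pi_gaussianReal_map_sum (fun _ : Fin D × Mode d N => (0 : ℝ))
      (fun p => modeVar β p.2) c
    have hsum : ∀ X : Fin D × Mode d N → ℝ,
        ∑ p, X p * c p = ∑ k : Mode d N, X (i, k) * incr x y k := by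
      intro X
      rw [Fintype.sum_prod_type, Finset.sum_eq_single i]
      · simp [hc]
      · intro j _ hj
        simp [hc, hj]
      · simp
    have hvar : ((∑ p : Fin D × Mode d N, modeVar β p.2 * (c p ^ 2).toNNReal : ℝ≥0) : ℝ) =
        resistance x y / (2 * β) := by
      rw [NNReal.coe_sum, Fintype.sum_prod_type, Finset.sum_eq_single i]
      · rw [resistance, Finset.sum_div]
        refine Finset.sum_congr rfl fun k _ => ?_
        have := lam_pos k
        rw [NNReal.coe_mul, coe_modeVar hβ, Real.coe_toNNReal _ (sq_nonneg _)]
        simp only [hc, if_true]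
        field_simp
      · intro j _ hj
        simp [hc, hj]
      · simp
    have hset : B x y i = (fun X : Fin D × Mode d N → ℝ => ∑ p, X p * c p) ⁻¹'
        {t | r / D ≤ |t|} := by
      ext X
      simp only [hB, Set.mem_preimage, Set.mem_ofPred_eq, hsum]
    have hm : Measurable fun X : Fin D × Mode d N → ℝ => ∑ p, X p * c p := by fun_prop
    rw [hset, ← Measure.map_apply hm (measurableSet_le (by fun_prop) (by fun_prop)),
      gaussianLaw_eq, hmap]
    simp only [zero_mul, Finset.sum_const_zero]
    have hle : resistance x y / (2 * β) ≤ S / β := by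
      rw [div_le_div_iff₀ (by positivity) hβ]
      have := mul_le_mul_of_nonneg_right (hres x y) hβ.le
      linarith
    refine (gaussianReal_abs_ge_le _ (r := r / D) (s := S / β) (by positivity) (by positivity)
      (by rw [hvar]; exact hle)).trans (le_of_eq ?_)
    congr 3
    field_simp
  calc _ ≤ _ := measure_mono hsub
    _ ≤ ∑ _x : Site d N, ∑ _y : Site d N, ∑ _i : Fin D,
          ENNReal.ofReal (2 * Real.exp (-(β * r ^ 2 / (2 * D ^ 2 * S)))) := by
        refine (measure_biUnion_finset_le _ _).trans (Finset.sum_le_sum fun x _ => ?_)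
        refine (measure_biUnion_finset_le _ _).trans (Finset.sum_le_sum fun y _ => ?_)
        refine (measure_biUnion_finset_le _ _).trans (Finset.sum_le_sum fun i _ => ?_)
        exact hone x y i
    _ = _ := by
        simp only [Finset.sum_const, Finset.card_univ, Fintype.card_fin, nsmul_eq_mul]
        rw [ENNReal.ofReal_mul (p := ((2 * (N : ℝ) + 1) ^ d) ^ 2 * D) (by positivity),
          ENNReal.ofReal_mul (p := ((2 * (N : ℝ) + 1) ^ d) ^ 2) (by positivity), ← card_site,
          ENNReal.ofReal_pow (by positivity), ENNReal.ofReal_natCast, ENNReal.ofReal_natCast]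
        ring

lemma tendsto_pow_mul_exp_neg_mul {c : ℝ} (hc : 0 < c) (m : ℕ) (K : ℝ) :
    Tendsto (fun N : ℕ => K * ((N : ℝ) ^ m * Real.exp (-(c * N)))) atTop (𝓝 0) := by
  have h1 : Tendsto (fun N : ℕ => c * (N : ℝ)) atTop atTop :=
    tendsto_natCast_atTop_atTop.const_mul_atTop hc
  have h2 := ((Real.tendsto_pow_mul_exp_neg_atTop_nhds_zero m).comp h1).const_mul (K / c ^ m)
  rw [mul_zero] at h2
  refine h2.congr fun N => ?_
  simp only [Function.comp, mul_pow]
  field_simp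

/-- If the partition function is at least `exp (-C (β + γ) N ^ E)`, then every event whose
unnormalised weight is at most `exp (-2 C (β + γ) N ^ E)`, up to polynomial factors, has vanishing
probability. Here these events are `effectiveRadius < r` and `R < effectiveRadius`. -/
lemma tendsto_selfAvoidingLaw {d D : ℕ} (hD : 1 ≤ D) {β γ C E : ℝ} (hβ : 0 < β) (hγ : 0 < γ) (hC : 0 < C)
    (hE : 1 ≤ E) {r R S : ℕ → ℝ}
    (hZ : ∀ᶠ N : ℕ in atTop,
      Real.exp (-(C * (β + γ) * (N : ℝ) ^ E)) ≤ partitionFunction d D N β γ)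
    (hr : ∀ᶠ N : ℕ in atTop, 0 ≤ r N ∧
      2 * (C * (β + γ) * (N : ℝ) ^ E) ≤ γ * (((2 * N + 1 : ℝ) ^ d) ^ 2 / (2 * r N + 1) ^ D))
    (hS : ∀ᶠ N : ℕ in atTop, 0 < S N ∧ ∀ x y : Site d N, resistance x y ≤ 2 * S N)
    (hR : ∀ᶠ N : ℕ in atTop, 0 ≤ R N ∧
      2 * (C * (β + γ) * (N : ℝ) ^ E) ≤ β * R N ^ 2 / (2 * D ^ 2 * S N)) :
    Tendsto (fun N : ℕ => selfAvoidingLaw d D N β γ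
      {X | r N ≤ effectiveRadius (field d D N X) ∧ effectiveRadius (field d D N X) ≤ R N})
      atTop (𝓝 1) := by
  obtain ⟨c, hc⟩ : ∃ c, c = C * (β + γ) := ⟨_, rfl⟩
  have hc0 : 0 < c := by rw [hc]; positivity
  simp only [← hc] at hZ hr hR
  have hlim : Tendsto (fun N : ℕ => 1 - ENNReal.ofReal
      ((1 + 2 * D * 9 ^ d) * ((N : ℝ) ^ (2 * d) * Real.exp (-(c * N))))) atTop (𝓝 1) := by
    have h1 := ENNReal.tendsto_ofReal
      (tendsto_pow_mul_exp_neg_mul hc0 (2 * d) (1 + 2 * D * 9 ^ d))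
    rw [ENNReal.ofReal_zero] at h1
    have h2 := ENNReal.Tendsto.sub (tendsto_const_nhds (x := (1 : ℝ≥0∞))) h1
      (Or.inl ENNReal.one_ne_top)
    simpa using h2
  refine tendsto_of_tendsto_of_tendsto_of_le_of_le' hlim tendsto_const_nhds ?_ ?_
  · filter_upwards [hZ, hr, hS, hR, eventually_ge_atTop 1] with N hZ hr hS hR hN
    obtain ⟨hr0, hr⟩ := hr
    obtain ⟨hS0, hS⟩ := hS
    obtain ⟨hR0, hR⟩ := hR
    have hN1 : (1 : ℝ) ≤ N := by exact_mod_cast hN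
    have hZ0 : 0 < partitionFunction d D N β γ := (Real.exp_pos _).trans_le hZ
    have hNT : (N : ℝ) ≤ (N : ℝ) ^ E := by
      simpa using Real.rpow_le_rpow_of_exponent_le hN1 hE
    set T := (N : ℝ) ^ E
    set A := {X | r N ≤ effectiveRadius (field d D N X) ∧ effectiveRadius (field d D N X) ≤ R N}
    set A₁ := {X | effectiveRadius (field d D N X) < r N}
    set A₂ := {X | R N < effectiveRadius (field d D N X)}
    have hdiv : ∀ q : ℝ, 0 ≤ q → q * Real.exp (-(2 * (c * T))) / partitionFunction d D N β γ ≤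
        q * Real.exp (-(c * N)) := by
      intro q hq
      rw [div_le_iff₀ hZ0]
      calc q * Real.exp (-(2 * (c * T))) = q * Real.exp (-(c * T)) * Real.exp (-(c * T)) := by
            rw [mul_assoc, ← Real.exp_add]; ring_nf
        _ ≤ q * Real.exp (-(c * N)) * partitionFunction d D N β γ := by gcongr
    have h1 : selfAvoidingLaw d D N β γ A₁ ≤ ENNReal.ofReal (1 * Real.exp (-(c * N))) := by
      refine (selfAvoidingLaw_le hZ0 (c := 1 * Real.exp (-(2 * (c * T)))) fun X hX => ?_).trans ?_
      · rw [weight_field, one_mul]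
        refine Real.exp_le_exp.2 (neg_le_neg (hr.trans (mul_le_mul_of_nonneg_left ?_ hγ.le)))
        refine le_trans ?_ (div_le_integral_localTime_sq (field d D N X))
        have hX' : effectiveRadius (field d D N X) < r N := hX
        have := effectiveRadius_nonneg (field d D N X)
        gcongr
      · calc _ ≤ ENNReal.ofReal (1 * Real.exp (-(2 * (c * T))) / partitionFunction d D N β γ) * 1 :=
              mul_le_mul' le_rfl prob_le_one
          _ ≤ _ := by
              rw [mul_one]
              exact ENNReal.ofReal_le_ofReal (hdiv 1 zero_le_one)
    have h2 : selfAvoidingLaw d D N β γ A₂ ≤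
        ENNReal.ofReal (((2 * N + 1) ^ d) ^ 2 * D * 2 * Real.exp (-(c * N))) := by
      refine (selfAvoidingLaw_le hZ0 (c := 1) fun X _ => weight_field_le_one hγ X).trans ?_
      refine (mul_le_mul' le_rfl (gaussianLaw_lt_effectiveRadius_le hD hβ hR0 hS0 hS)).trans ?_
      rw [← ENNReal.ofReal_mul (by positivity)]
      refine ENNReal.ofReal_le_ofReal (le_trans ?_ (hdiv _ (by positivity)))
      rw [div_mul_eq_mul_div, one_mul, mul_assoc _ 2]
      gcongr
    have hcov : (Set.univ : Set (Fin D × Mode d N → ℝ)) ⊆ A ∪ (A₁ ∪ A₂) := by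
      intro X _
      by_cases h1 : effectiveRadius (field d D N X) < r N
      · exact Or.inr (Or.inl h1)
      · by_cases h2 : R N < effectiveRadius (field d D N X)
        · exact Or.inr (Or.inr h2)
        · exact Or.inl ⟨not_lt.1 h1, not_lt.1 h2⟩
    rw [tsub_le_iff_right, ← selfAvoidingLaw_univ β hγ hZ0]
    refine (measure_mono hcov).trans ((measure_union_le _ _).trans ?_)
    refine add_le_add le_rfl ((measure_union_le _ _).trans ((add_le_add h1 h2).trans ?_))
    rw [← ENNReal.ofReal_add (by positivity) (by positivity)]
    refine ENNReal.ofReal_le_ofReal ?_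
    have hn : ((2 * N + 1 : ℝ) ^ d) ^ 2 ≤ 9 ^ d * (N : ℝ) ^ (2 * d) := by
      calc ((2 * N + 1 : ℝ) ^ d) ^ 2 ≤ ((3 * N) ^ d) ^ 2 := by gcongr; linarith
        _ = _ := by rw [← pow_mul, mul_pow, mul_comm d 2, pow_mul 3 2 d]; norm_num
    have hone : (1 : ℝ) ≤ (N : ℝ) ^ (2 * d) := one_le_pow₀ hN1
    have hexp : 0 < Real.exp (-(c * N)) := Real.exp_pos _
    calc _ = (1 + ((2 * N + 1 : ℝ) ^ d) ^ 2 * D * 2) * Real.exp (-(c * N)) := by ring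
      _ ≤ ((N : ℝ) ^ (2 * d) + 9 ^ d * (N : ℝ) ^ (2 * d) * D * 2) * Real.exp (-(c * N)) := by
        gcongr
      _ = _ := by ring
  · filter_upwards [hZ] with N hZ
    rw [← selfAvoidingLaw_univ β hγ ((Real.exp_pos _).trans_le hZ)]
    exact measure_mono (Set.subset_univ _)

/-! ### The scales of the lower and the upper bound -/

/-- The self-intersection energy forced by a radius below the scale of the lower bound is twice the
cost `C (β + γ) N ^ E` paid by the partition function. -/
lemma two_mul_le_of_radius_le {d D : ℕ} (hD : 1 ≤ D) {β γ C α E : ℝ} (hβ : 0 < β) (hγ : 0 < γ)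
    (hC : 1 ≤ C) (hE : α * D + E = 2 * d) {N : ℕ} (hN : 1 ≤ N) {r r' : ℝ}
    (hr' : r' = 1 / (6 * C) * (γ / (β + γ)) ^ (1 / (D : ℝ)) * (N : ℝ) ^ α)
    (h1 : 1 ≤ r') (h0 : 0 ≤ r) (hrr : r ≤ r') :
    2 * (C * (β + γ) * (N : ℝ) ^ E) ≤ γ * (((2 * N + 1 : ℝ) ^ d) ^ 2 / (2 * r + 1) ^ D) := by
  have hN0 : (0 : ℝ) < N := by exact_mod_cast hN
  have hD0 : (D : ℝ) ≠ 0 := by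
    have : (1 : ℝ) ≤ D := by exact_mod_cast hD
    linarith
  have hC0 : 0 < C := by linarith
  have hvol : (2 * r + 1) ^ D ≤ 1 / (2 * C) * (γ / (β + γ)) * (N : ℝ) ^ (α * D) := by
    calc (2 * r + 1) ^ D ≤ (3 * r') ^ D := by gcongr; linarith
      _ = (1 / (2 * C)) ^ D * (γ / (β + γ)) * (N : ℝ) ^ (α * D) := by
        have h2 : 3 * r' = 1 / (2 * C) * (γ / (β + γ)) ^ (1 / (D : ℝ)) * (N : ℝ) ^ α := by
          rw [hr']; field_simp; ring
        rw [h2, mul_pow, mul_pow, ← Real.rpow_natCast (_ ^ (1 / (D : ℝ))),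
          ← Real.rpow_mul (by positivity), one_div_mul_cancel hD0, Real.rpow_one,
          ← Real.rpow_natCast (_ ^ α), ← Real.rpow_mul hN0.le]
      _ ≤ _ := by
        gcongr
        refine pow_le_of_le_one (by positivity) ?_ (by omega)
        rw [div_le_one (by positivity)]
        linarith
  rw [mul_div_assoc', le_div_iff₀ (by positivity)]
  calc 2 * (C * (β + γ) * (N : ℝ) ^ E) * (2 * r + 1) ^ D
      ≤ 2 * (C * (β + γ) * (N : ℝ) ^ E) *
        (1 / (2 * C) * (γ / (β + γ)) * (N : ℝ) ^ (α * D)) := by gcongr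
    _ = γ * ((N : ℝ) ^ (α * D) * (N : ℝ) ^ E) := by field_simp
    _ = γ * ((N : ℝ) ^ d) ^ 2 := by
        rw [← Real.rpow_add hN0, hE, ← Real.rpow_natCast, ← Real.rpow_natCast,
          ← Real.rpow_mul hN0.le]
        congr 2
        push_cast
        ring
    _ ≤ γ * ((2 * N + 1 : ℝ) ^ d) ^ 2 := by gcongr; linarith

lemma eventually_one_le_mul_rpow {c α : ℝ} (hc : 0 < c) (hα : 0 < α) :
    ∀ᶠ N : ℕ in atTop, 1 ≤ c * (N : ℝ) ^ α :=
  (((tendsto_rpow_atTop hα).comp tendsto_natCast_atTop_atTop).const_mul_atTop hc).eventually_ge_atTop 1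

lemma eventually_one_le_log : ∀ᶠ N : ℕ in atTop, 1 ≤ Real.log N :=
  (Real.tendsto_log_atTop.comp tendsto_natCast_atTop_atTop).eventually_ge_atTop 1

lemma eventually_log_sq_le {c : ℝ} (hc : 0 < c) :
    ∀ᶠ N : ℕ in atTop, Real.log N ^ 2 ≤ c * ((N : ℝ) ^ (1 / 3 : ℝ)) ^ 2 := by
  have h := ((isLittleO_log_rpow_atTop (r := 1 / 3) (by norm_num)).bound
    (Real.sqrt_pos.2 hc)).natCast_atTop
  filter_upwards [h] with N hN
  rw [← sq_abs, ← Real.norm_eq_abs]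
  calc ‖Real.log N‖ ^ 2 ≤ (√c * ‖(N : ℝ) ^ (1 / 3 : ℝ)‖) ^ 2 := by gcongr
    _ = _ := by rw [mul_pow, Real.sq_sqrt hc.le, Real.norm_eq_abs, sq_abs]

lemma natLog_le_log {N : ℕ} (hN : 3 ≤ N) : (Nat.log 2 (2 * N + 1) : ℝ) ≤ 3 * Real.log N := by
  have hN' : (3 : ℝ) ≤ N := by exact_mod_cast hN
  have h1 := Real.natLog_le_logb (2 * N + 1) 2
  have h2 : Real.log ((2 * N + 1 : ℕ) : ℝ) ≤ 2 * Real.log N := by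
    rw [← Real.log_rpow (by linarith)]
    refine Real.log_le_log (by positivity) ?_
    push_cast
    norm_num
    nlinarith
  have h3 := Real.log_two_gt_d9
  have h4 : 0 < Real.log N := Real.log_pos (by linarith)
  refine h1.trans ?_
  rw [Real.logb, Nat.cast_ofNat, div_le_iff₀ (by linarith)]
  nlinarith

lemma resistance_le_log_sq {N : ℕ} (hN : 3 ≤ N) (hlog : 1 ≤ Real.log N) (x y : Site 2 N) :
    resistance x y ≤ 2 * (14 * Real.log N) ^ 2 := by
  refine (resistance_le_of_two x y).trans ?_
  have := natLog_le_log hN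
  gcongr
  linarith

theorem tendsto_effectiveRadius_of_three_le {d D : ℕ} (hd : 3 ≤ d) (hD : 1 ≤ D) (hDd : D ≤ d) :
    ∃ ε₀ K₀ : ℝ, 0 < ε₀ ∧ 0 < K₀ ∧ ∀ β γ : ℝ, 0 < β → 0 < γ →
      Tendsto (fun N : ℕ => selfAvoidingLaw d D N β γ
        {X | ε₀ * (γ / (β + γ)) ^ (1 / (D : ℝ))
              * (N : ℝ) ^ (1 / (D : ℝ) * ((d : ℝ) - 2 * ((d : ℝ) - (D : ℝ)) / ((D : ℝ) + 2)))
              ≤ effectiveRadius (field d D N X) ∧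
            effectiveRadius (field d D N X)
              ≤ K₀ * ((β + γ) / β) ^ (1 / 2 : ℝ)
                * (N : ℝ) ^ ((d : ℝ) / 2 + ((d : ℝ) - (D : ℝ)) / ((D : ℝ) + 2))})
        atTop (𝓝 1) := by
  have hD' : (1 : ℝ) ≤ D := by exact_mod_cast hD
  have hd' : (3 : ℝ) ≤ d := by exact_mod_cast hd
  have hDd' : (D : ℝ) ≤ d := by exact_mod_cast hDd
  -- `M` is the quotient of the upper and the lower bound for the resistance of distinct sites
  set M : ℝ := 2 * 3 ^ d * (9 * d) ^ 2 with hM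
  have h3d : (1 : ℝ) ≤ 3 ^ d := one_le_pow₀ (by norm_num)
  have hM1 : 1 ≤ M := by nlinarith
  set C : ℝ := 3 ^ d + 9 ^ d * (24 + 16 * M) ^ D + D * 3 ^ (2 * d + 1) with hC
  have hC1 : 1 ≤ C := by
    have h1 : (0 : ℝ) ≤ 9 ^ d * (24 + 16 * M) ^ D := by positivity
    have h2 : (0 : ℝ) ≤ D * 3 ^ (2 * d + 1) := by positivity
    linarith
  have hC0 : 0 < C := by linarith
  refine ⟨1 / (6 * C), 2 * C * D * (9 * d), by positivity, by positivity, ?_⟩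
  intro β γ hβ hγ
  set E : ℝ := (d : ℝ) + 2 * (d - D) / (D + 2) with hE
  have hE1 : 1 ≤ E := by
    have : (0 : ℝ) ≤ 2 * (d - D) / (D + 2) := by
      have : (0 : ℝ) ≤ (d : ℝ) - D := by linarith
      positivity
    linarith
  set α : ℝ := 1 / (D : ℝ) * ((d : ℝ) - 2 * ((d : ℝ) - (D : ℝ)) / ((D : ℝ) + 2)) with hα
  have hα0 : 0 < α := by
    refine mul_pos (by positivity) ?_
    have : 2 * ((d : ℝ) - D) / (D + 2) < d := by
      rw [div_lt_iff₀ (by positivity)]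
      nlinarith
    linarith
  refine tendsto_selfAvoidingLaw hD hβ hγ hC0 hE1 (S := fun _ => (9 * d) ^ 2) ?_ ?_ ?_ ?_
  · filter_upwards [eventually_ge_atTop 1] with N hN
    refine exp_rpow_le_partitionFunction (by omega) hDd hN hβ hγ rfl
      (w₀ := 1 / (2 * 3 ^ d * β) + 2 * ((N : ℝ) ^ (((d : ℝ) - D) / (D + 2))) ^ 2) ?_ hM1 ?_
    · have h1 : (0 : ℝ) ≤ 1 / (2 * 3 ^ d * β) := by positivity
      nlinarith [sq_nonneg ((N : ℝ) ^ (((d : ℝ) - D) / (D + 2)))]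
    · intro x y hxy
      have h1 := le_resistance (by omega) hxy
      have h2 := resistance_le_of_three_le hd x y
      have ha2 := sq_nonneg ((N : ℝ) ^ (((d : ℝ) - D) / (D + 2)))
      generalize ((N : ℝ) ^ (((d : ℝ) - D) / (D + 2))) ^ 2 = a2 at *
      constructor
      · refine add_le_add ?_ le_rfl
        calc 1 / (2 * 3 ^ d * β) = 1 / 3 ^ d / (2 * β) := by field_simp
          _ ≤ _ := by gcongr
      · rw [mul_add]
        refine add_le_add ?_ (le_mul_of_one_le_left (by positivity) hM1)
        calc resistance x y / (2 * β) ≤ 2 * (9 * d) ^ 2 / (2 * β) := by gcongr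
          _ = _ := by rw [hM]; field_simp
  · filter_upwards [eventually_ge_atTop 1, eventually_one_le_mul_rpow
      (c := 1 / (6 * C) * (γ / (β + γ)) ^ (1 / (D : ℝ))) (by positivity) hα0] with N hN h1
    refine ⟨by positivity, two_mul_le_of_radius_le hD hβ hγ hC1 ?_ hN rfl h1 (by positivity) le_rfl⟩
    rw [hα, hE]
    field_simp
    ring
  · exact Eventually.of_forall fun N => ⟨by positivity, fun x y => resistance_le_of_three_le hd x y⟩
  · filter_upwards [eventually_ge_atTop 1] with N hN
    have hN0 : (0 : ℝ) < N := by exact_mod_cast hN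
    refine ⟨by positivity, ?_⟩
    have h1 : (((β + γ) / β) ^ (1 / 2 : ℝ)) ^ 2 = (β + γ) / β := by
      rw [← Real.rpow_natCast, ← Real.rpow_mul (by positivity)]; norm_num
    have h2 : ((N : ℝ) ^ ((d : ℝ) / 2 + ((d : ℝ) - (D : ℝ)) / ((D : ℝ) + 2))) ^ 2 = N ^ E := by
      rw [← Real.rpow_natCast, ← Real.rpow_mul hN0.le, hE]
      congr 1
      push_cast
      ring
    rw [mul_pow, mul_pow, h1, h2]
    have h3 : β * ((2 * C * D * (9 * d)) ^ 2 * ((β + γ) / β) * (N : ℝ) ^ E) /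
        (2 * D ^ 2 * (9 * d) ^ 2) = 2 * (C * (C * (β + γ) * (N : ℝ) ^ E)) := by
      field_simp
    rw [h3]
    have : 0 ≤ C * (β + γ) * (N : ℝ) ^ E := by positivity
    nlinarith

theorem tendsto_effectiveRadius_two_one :
    ∃ ε₀ K₀ : ℝ, 0 < ε₀ ∧ 0 < K₀ ∧ ∀ β γ : ℝ, 0 < β → 0 < γ →
      Tendsto (fun N : ℕ => selfAvoidingLaw 2 1 N β γ
        {X | ε₀ * (γ / (β + γ)) * (N : ℝ) ^ (4 / 3 : ℝ) * Real.log N ^ (-(2 / 3) : ℝ)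
              ≤ effectiveRadius (field 2 1 N X) ∧
            effectiveRadius (field 2 1 N X)
              ≤ K₀ * ((β + γ) / β) ^ (1 / 2 : ℝ) * (N : ℝ) ^ (4 / 3 : ℝ)
                * Real.log N ^ (4 / 3 : ℝ)})
        atTop (𝓝 1) := by
  set C : ℝ := 3 ^ 2 + 9 ^ 2 * (24 + 16 * 2) ^ 1 + (1 : ℕ) * 3 ^ (2 * 2 + 1) with hC
  have hC1 : 1 ≤ C := by norm_num [hC]
  have hC0 : 0 < C := by linarith
  -- the slope `N ^ (1 / 3)` dominates the logarithmic standard deviation of the increments, so that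
  -- `w₀ = 2 a²` and `M = 2` are admissible for large `N`
  refine ⟨1 / (6 * C), 28 * C, by positivity, by positivity, ?_⟩
  intro β γ hβ hγ
  have hE : ((2 : ℕ) : ℝ) + 2 * ((2 : ℕ) - (1 : ℕ)) / ((1 : ℕ) + 2) = 8 / 3 := by norm_num
  have ha : (((2 : ℕ) : ℝ) - (1 : ℕ)) / ((1 : ℕ) + 2) = 1 / 3 := by norm_num
  refine tendsto_selfAvoidingLaw le_rfl hβ hγ hC0 (E := 8 / 3) (by norm_num)
    (S := fun N => (14 * Real.log N) ^ 2) ?_ ?_ ?_ ?_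
  · filter_upwards [eventually_ge_atTop 3, eventually_one_le_log,
      eventually_log_sq_le (c := β / 196) (by positivity)] with N hN hlog hlog2
    rw [← hE]
    refine exp_rpow_le_partitionFunction le_rfl (by norm_num) (by omega) hβ hγ rfl
      (w₀ := 2 * ((N : ℝ) ^ ((((2 : ℕ) : ℝ) - (1 : ℕ)) / ((1 : ℕ) + 2))) ^ 2) ?_ one_le_two ?_
    · nlinarith [sq_nonneg ((N : ℝ) ^ ((((2 : ℕ) : ℝ) - (1 : ℕ)) / ((1 : ℕ) + 2)))]
    · intro x y hxy
      rw [ha]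
      have h1 : 0 ≤ resistance x y / (2 * β) := div_nonneg (resistance_nonneg x y) (by positivity)
      have h2 : resistance x y / (2 * β) ≤ ((N : ℝ) ^ (1 / 3 : ℝ)) ^ 2 := by
        rw [div_le_iff₀ (by positivity)]
        calc resistance x y ≤ 2 * (14 * Real.log N) ^ 2 := resistance_le_log_sq hN hlog x y
          _ = 392 * Real.log N ^ 2 := by ring
          _ ≤ 392 * (β / 196 * ((N : ℝ) ^ (1 / 3 : ℝ)) ^ 2) := by gcongr
          _ = _ := by ring
      constructor <;> linarith [sq_nonneg ((N : ℝ) ^ (1 / 3 : ℝ))]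
  · filter_upwards [eventually_ge_atTop 3, eventually_one_le_log, eventually_one_le_mul_rpow
      (c := 1 / (6 * C) * (γ / (β + γ))) (by positivity) (by norm_num : (0 : ℝ) < 4 / 3)]
      with N hN hlog h1
    have h0 : 0 ≤ 1 / (6 * C) * (γ / (β + γ)) * (N : ℝ) ^ (4 / 3 : ℝ) *
        Real.log N ^ (-(2 / 3) : ℝ) := by positivity
    refine ⟨h0, two_mul_le_of_radius_le le_rfl hβ hγ hC1 (α := 4 / 3) (by norm_num) (by omega)
      (r' := 1 / (6 * C) * (γ / (β + γ)) * (N : ℝ) ^ (4 / 3 : ℝ)) (by simp) h1 h0 ?_⟩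
    exact mul_le_of_le_one_right (by positivity)
      (Real.rpow_le_one_of_one_le_of_nonpos hlog (by norm_num))
  · filter_upwards [eventually_ge_atTop 3, eventually_one_le_log] with N hN hlog
    exact ⟨by positivity, fun x y => resistance_le_log_sq hN hlog x y⟩
  · filter_upwards [eventually_ge_atTop 3, eventually_one_le_log] with N hN hlog
    have hN0 : (0 : ℝ) < N := by exact_mod_cast (by omega : 0 < N)
    have hlog0 : 0 < Real.log N := by linarith
    refine ⟨by positivity, ?_⟩
    have h1 : (((β + γ) / β) ^ (1 / 2 : ℝ)) ^ 2 = (β + γ) / β := by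
      rw [← Real.rpow_natCast, ← Real.rpow_mul (by positivity)]; norm_num
    have h2 : ((N : ℝ) ^ (4 / 3 : ℝ)) ^ 2 = (N : ℝ) ^ (8 / 3 : ℝ) := by
      rw [← Real.rpow_natCast, ← Real.rpow_mul hN0.le]; norm_num
    have h3 : Real.log N ^ 2 ≤ (Real.log N ^ (4 / 3 : ℝ)) ^ 2 := by
      gcongr
      simpa using Real.rpow_le_rpow_of_exponent_le hlog (by norm_num : (1 : ℝ) ≤ 4 / 3)
    rw [mul_pow, mul_pow, mul_pow, h1, h2, le_div_iff₀ (by positivity)]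
    have hT : 0 < (N : ℝ) ^ (8 / 3 : ℝ) := by positivity
    generalize (N : ℝ) ^ (8 / 3 : ℝ) = T at *
    calc 2 * (C * (β + γ) * T) * (2 * ((1 : ℕ) : ℝ) ^ 2 * (14 * Real.log N) ^ 2)
        = (28 ^ 2 * (β + γ) * T * Real.log N ^ 2) * C := by push_cast; ring
      _ ≤ (28 ^ 2 * (β + γ) * T * Real.log N ^ 2) * C ^ 2 := by
          gcongr
          exact le_self_pow₀ hC1 two_ne_zero
      _ ≤ (28 ^ 2 * (β + γ) * T * (Real.log N ^ (4 / 3 : ℝ)) ^ 2) * C ^ 2 := by gcongr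
      _ = β * ((28 * C) ^ 2 * ((β + γ) / β) * T * (Real.log N ^ (4 / 3 : ℝ)) ^ 2) := by
          field_simp

end ElasticManifold

end

theorem theorem1 :
    -- the case `d = 2`, `D = 1`
    (∃ ε₀ K₀ : ℝ, 0 < ε₀ ∧ 0 < K₀ ∧ ∀ β γ : ℝ, 0 < β → 0 < γ →
      Tendsto (fun N : ℕ => ElasticManifold.selfAvoidingLaw 2 1 N β γ
        {X | ε₀ * (γ / (β + γ)) * (N : ℝ) ^ (4 / 3 : ℝ) * Real.log N ^ (-(2 / 3) : ℝ)
              ≤ ElasticManifold.effectiveRadius (ElasticManifold.field 2 1 N X) ∧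
            ElasticManifold.effectiveRadius (ElasticManifold.field 2 1 N X)
              ≤ K₀ * ((β + γ) / β) ^ (1 / 2 : ℝ) * (N : ℝ) ^ (4 / 3 : ℝ)
                * Real.log N ^ (4 / 3 : ℝ)})
        atTop (𝓝 1)) ∧
    -- the case `d ≥ 3`, `1 ≤ D ≤ d`
    (∀ d D : ℕ, 3 ≤ d → 1 ≤ D → D ≤ d →
      ∃ ε₀ K₀ : ℝ, 0 < ε₀ ∧ 0 < K₀ ∧ ∀ β γ : ℝ, 0 < β → 0 < γ →
        Tendsto (fun N : ℕ => ElasticManifold.selfAvoidingLaw d D N β γ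
          {X | ε₀ * (γ / (β + γ)) ^ (1 / (D : ℝ))
                * (N : ℝ) ^ (1 / (D : ℝ) * ((d : ℝ) - 2 * ((d : ℝ) - (D : ℝ)) / ((D : ℝ) + 2)))
                ≤ ElasticManifold.effectiveRadius (ElasticManifold.field d D N X) ∧
              ElasticManifold.effectiveRadius (ElasticManifold.field d D N X)
                ≤ K₀ * ((β + γ) / β) ^ (1 / 2 : ℝ)
                  * (N : ℝ) ^ ((d : ℝ) / 2 + ((d : ℝ) - (D : ℝ)) / ((D : ℝ) + 2))})
          atTop (𝓝 1)) :=
  ⟨ElasticManifold.tendsto_effectiveRadius_two_one, fun _ _ hd hD hDd =>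
    ElasticManifold.tendsto_effectiveRadius_of_three_le hd hD hDd⟩
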